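/- Let $q$ be a prime power, $m=2h\ge 4$ an even integer, $\lambda$ a positive divisor of $q-1$, and $n=\frac{q^m-1}{\lambda}$. Let $\alpha$ be a primitive element of $\mathbb{F}_{q^m}$ (a generator of $\mathbb{F}_{q^m}^*$) and $\theta=\alpha^\lambda$, a primitive $n$-th root of unity. For an integer $\delta\ge 2$ let $\mathcal{C}_{(q,m,\lambda,\delta)}$ be the narrow-sense BCH code of length $n$ over $\mathbb{F}_q$ with designed distance $\delta$, i.e. the cyclic code of length $n$ with generator polynomial $\operatorname{lcm}(m_1(x),m_2(x),\ldots,m_{\delta-1}(x))$, where $m_i(x)$ is the minimal polynomial of $\theta^i$ over $\mathbb{F}_q$. Let $\delta$ be an integer with $1\le \delta-1\le \frac{q^{h+1}-1}{\lambda}$, write $\delta-1=\sum_{j=0}^h\delta_jq^j$ with $0\le\delta_j\le q-1$, and put $\overline{\delta}=\left\lceil \frac{(\delta-1)(q-1)}{q}\right\rceil$. Then $\mathcal{C}_{(q,m,\lambda,\delta)}$ has length $n$, minimum distance $d\ge\delta$ and dimension $k$, where: (i) if $\delta\le q^h+1$, then with $\varepsilon=\left\lfloor\frac{(\delta-2)\lambda}{q^h-1}\right\rfloor$,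 $$k=\begin{cases} n-m\overline{\delta} & \text{if } \varepsilon<\left\lfloor\frac{\lambda}{2}\right\rfloor,\\ n-m\overline{\delta}+m\left(\varepsilon-\frac{\lambda-1}{2}\right) & \text{if } \left\lfloor\frac{\lambda}{2}\right\rfloor\le\varepsilon<\lambda,\\ n-m\overline{\delta}+m\,\frac{\lambda-1}{2} & \text{if } \varepsilon=\lambda;\end{cases}$$ (ii) if $\delta\ge q^h+2$ and $\delta_h<\frac{q-1}{\lambda}$, then with $\vartheta=\left\lfloor\frac{(\delta-2-\delta_hq^h)\lambda}{q^h-1}\right\rfloor$ and $s=\delta_hq^h+\frac{\vartheta(q^h-1)}{\lambda}$, $$k=\begin{cases} n-m\overline{\delta}+m\frac{\lambda\delta_h^2+2(\delta_0-\delta_h)+1}{2} & \text{if } \delta\le\delta_hq^h+\delta_h,\\ n-m\overline{\delta}+m\frac{\lambda\delta_h^2}{2} & \text{if } \delta_hq^h+\delta_h<\delta\le\delta_hq^h+\frac{q^h-1}{\lambda}+1,\\ n-m\overline{\delta}+m\frac{\lambda\delta_h^2}{2}+m\left[(\vartheta-1)\delta_h+\delta_0-\frac{\vartheta(q-1)}{\lambda}\right]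 & \text{if } s+1<\delta\le s+\delta_h+1 \text{ and } 1\le\vartheta\le\frac{\lambda}{2},\\ n-m\overline{\delta}+m\frac{\lambda\delta_h^2}{2}+m\left[(\vartheta-1)\delta_h+\delta_0-\frac{\vartheta(q-1)}{\lambda}\right]+m\left(\vartheta-\frac{\lambda+1}{2}\right) & \text{if } s+1<\delta\le s+\delta_h+1 \text{ and } \vartheta>\frac{\lambda}{2},\\ n-m\overline{\delta}+m\frac{\lambda\delta_h^2}{2}+m\vartheta\delta_h & \text{if } s+\delta_h+1<\delta \text{ and } 1\le\vartheta<\frac{\lambda}{2},\\ n-m\overline{\delta}+m\frac{\lambda\delta_h^2}{2}+m\vartheta\delta_h+m\left(\vartheta-\frac{\lambda-1}{2}\right) & \text{if } s+\delta_h+1<\delta \text{ and } \vartheta\ge\frac{\lambda}{2};\end{cases}$$ (iii) if $\delta\ge q^h+2$ and $\delta_h=\frac{q-1}{\lambda}$, then $$k=\begin{cases} n-m\overline{\delta}+m\frac{\lambda\delta_h^2+2(\delta_0-\delta_h)+1}{2} & \text{if } \delta\le\delta_hq^h+\delta_h,\\ n-m\overline{\delta}+m\frac{\lambda\delta_h^2}{2}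 & \text{if } \delta>\delta_hq^h+\delta_h.\end{cases}$$ -/

import Mathlib

open Polynomial

noncomputable section

/-- The polynomial `c(x) = c_0 + c_1 x + ⋯ + c_{n-1} x^{n-1}` of a vector `c` of length `n`. -/
def wordPoly {F : Type*} [Field F] {n : ℕ} (c : Fin n → F) : F[X] :=
  ∑ i : Fin n, C (c i) * X ^ (i : ℕ)

/-- The code of length `n` over `F` generated by `g`: the vectors `c` for which `g` divides `c(x)`.
If `g` divides `x^n - 1` this is the cyclic code of length `n` with generator polynomial `g`. -/
def cyclicCode (F : Type*) [Field F] (n : ℕ) (g : F[X]) : Submodule F (Fin n → F) where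
  carrier := {c | g ∣ wordPoly c}
  zero_mem' := by simp [wordPoly]
  add_mem' := by
    intro a b ha hb
    have h : wordPoly (a + b) = wordPoly a + wordPoly b := by
      simp [wordPoly, add_mul, Finset.sum_add_distrib]
    simpa only [Set.mem_ofPred_eq, h] using dvd_add ha hb
  smul_mem' := by
    intro r a ha
    have h : wordPoly (r • a) = C r * wordPoly a := by
      simp [wordPoly, Finset.mul_sum, mul_assoc]
    simpa only [Set.mem_ofPred_eq, h] using Dvd.dvd.mul_left ha (C r)

open Classical in
/-- `lcm (m_b(x), m_{b+1}(x), …, m_{b+δ-2}(x))`, where `m_i(x)` is the minimal polynomial of `θ^i`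
over `F`. -/
def bchGenerator (F : Type*) [Field F] {K : Type*} [Field K] [Algebra F K]
    (θ : K) (b δ : ℕ) : F[X] :=
  letI : NormalizedGCDMonoid F[X] := UniqueFactorizationMonoid.toNormalizedGCDMonoid F[X]
  (Finset.Ico b (b + (δ - 1))).lcm fun i => minpoly F (θ ^ i)

/-- The narrow-sense (`b = 1`) BCH code of length `n` over `F` with designed distance `δ`, with
respect to the primitive `n`-th root of unity `θ` in the extension `K` of `F`. -/
def narrowSenseBCH (F : Type*) [Field F] {K : Type*} [Field K] [Algebra F K]
    (n : ℕ) (θ : K) (δ : ℕ) : Submodule F (Fin n → F) :=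
  cyclicCode F n (bchGenerator F θ 1 δ)

open Classical in
/-- The minimum distance: the least Hamming distance between two distinct codewords. -/
def minDist {F : Type*} [Field F] {n : ℕ} (D : Submodule F (Fin n → F)) : ℕ :=
  sInf {d | ∃ x ∈ D, ∃ y ∈ D, x ≠ y ∧ hammingDist x y = d}

end

/-! The dimension is `n` minus the degree of the generator, and that degree is the number of
distinct conjugates of `θ ^ i`, `1 ≤ i ≤ D = δ - 1`. So the task is to count `q`-cyclotomic classes
of the integers `lam * i` modulo `q ^ (2 * h) - 1`.

Multiples of `q` add no class, which leaves `D - D / q = δbar` values of `i`. Since `lam * D < q ^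
(h + 1)`, each `lam * i = q ^ h * v + u` fills at most `h + 1` of the `2 * h` digits. Two such
numbers prime to the base digit (last digit nonzero) are cyclic shifts of each other only if they
are equal or if their halves `u`, `v` are swapped (`eq_or_half_turn_of_modEq_mul_pow`). Classes have
size `2 * h`, or `h` when `u = v`. Hence the degree is `2 * h * δbar` minus `h` times a correction
in which `u < v` counts twice and `u = v` once (`natDegree_bchGenerator_add`).

As `q ≡ 1` modulo `lam`, the correction counts pairs with `lam ∣ u + v` below a lexicographic bound
(`V`, `U`); this is `pairCount`. Summing over `v` gives a closed form with a term `max 0 (2e - lam +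
1)`, the source of the thresholds at `lam / 2`. With `D = c * q ^ h + R` and `R = e * w + ρ`, where
`q ^ h - 1 = lam * w`, one gets `V = lam * c + e` and `U = lam * ρ - e`. The cases of the theorem
are the ranges of `e` (which is `ε` or `ϑ`) and the comparison of `ρ` with `c`.

The distance bound is the BCH bound. -/

/-! ### Words as polynomials; dimension of a cyclic code. -/

theorem coeff_wordPoly {F : Type*} [Field F] {n : ℕ} (c : Fin n → F) (j : Fin n) :
    (wordPoly c).coeff j = c j := by
  simp [wordPoly, finsetSum_coeff, coeff_C_mul, coeff_X_pow, Fin.val_inj]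

theorem degree_wordPoly_lt {F : Type*} [Field F] {n : ℕ} (c : Fin n → F) :
    (wordPoly c).degree < n := by
  refine lt_of_le_of_lt (degree_sum_le _ _) ?_
  refine (Finset.sup_lt_iff (WithBot.bot_lt_coe n)).mpr fun i _ => ?_
  exact (degree_C_mul_X_pow_le _ _).trans_lt (WithBot.coe_lt_coe.mpr i.2)

theorem wordPoly_coeff {F : Type*} [Field F] {n : ℕ} {p : F[X]} (hp : p.degree < n) :
    wordPoly (fun i : Fin n => p.coeff i) = p := by
  ext j
  by_cases hj : j < n
  · exact coeff_wordPoly (fun i : Fin n => p.coeff i) ⟨j, hj⟩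
  · have h : (n : WithBot ℕ) ≤ j := by exact_mod_cast not_lt.mp hj
    rw [coeff_eq_zero_of_degree_lt ((degree_wordPoly_lt _).trans_le h),
      coeff_eq_zero_of_degree_lt (hp.trans_le h)]

theorem wordPoly_eq_zero {F : Type*} [Field F] {n : ℕ} {c : Fin n → F} (h : wordPoly c = 0) :
    c = 0 := by
  ext j
  rw [← coeff_wordPoly c, h]
  simp

theorem mem_cyclicCode {F : Type*} [Field F] {n : ℕ} {g : F[X]} {c : Fin n → F} :
    c ∈ cyclicCode F n g ↔ g ∣ wordPoly c := Iff.rfl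

/-- Multiplication by `g` identifies polynomials of degree below `n - deg g` with the code; `g` need
not divide `x ^ n - 1`. -/
theorem finrank_cyclicCode {F : Type*} [Field F] {n : ℕ} {g : F[X]} (hg : g ≠ 0)
    (hn : g.natDegree ≤ n) : Module.finrank F (cyclicCode F n g) = n - g.natDegree := by
  let φ : degreeLT F (n - g.natDegree) →ₗ[F] (Fin n → F) :=
    { toFun := fun p i => (g * p.1).coeff i
      map_add' := by intro p r; ext i; simp [mul_add]
      map_smul' := by intro a p; ext i; simp }
  have hdeg (p : degreeLT F (n - g.natDegree)) : (g * p.1).degree < n := by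
    rcases eq_or_ne p.1 0 with h0 | h0
    · rw [h0, mul_zero, degree_zero]
      exact WithBot.bot_lt_coe n
    · have h1 := mem_degreeLT.mp p.2
      rw [degree_eq_natDegree h0] at h1
      have h2 : p.1.natDegree < n - g.natDegree := by exact_mod_cast h1
      rw [degree_eq_natDegree (mul_ne_zero hg h0), natDegree_mul hg h0]
      exact_mod_cast (by omega : g.natDegree + p.1.natDegree < n)
  have hword (p : degreeLT F (n - g.natDegree)) : wordPoly (φ p) = g * p.1 :=
    wordPoly_coeff (hdeg p)
  have hinj : Function.Injective φ := by
    intro p r h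
    have := congrArg wordPoly h
    rw [hword, hword] at this
    exact Subtype.ext (mul_left_cancel₀ hg this)
  have hrange : LinearMap.range φ = cyclicCode F n g := by
    ext c
    rw [LinearMap.mem_range, mem_cyclicCode]
    constructor
    · rintro ⟨p, rfl⟩
      exact ⟨p.1, hword p⟩
    · rintro ⟨p, hp⟩
      have hmem : p ∈ degreeLT F (n - g.natDegree) := by
        rw [mem_degreeLT]
        rcases eq_or_ne p 0 with h0 | h0
        · rw [h0, degree_zero]
          exact WithBot.bot_lt_coe _
        · have h1 := degree_wordPoly_lt c
          rw [hp, degree_eq_natDegree (mul_ne_zero hg h0), natDegree_mul hg h0] at h1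
          have h2 : g.natDegree + p.natDegree < n := by exact_mod_cast h1
          rw [degree_eq_natDegree h0]
          exact_mod_cast (by omega : p.natDegree < n - g.natDegree)
      refine ⟨⟨p, hmem⟩, ?_⟩
      ext j
      change (g * p).coeff j = c j
      rw [← hp, coeff_wordPoly]
  rw [← hrange, LinearMap.finrank_range_of_inj hinj, (degreeLTEquiv F _).finrank_eq,
    Module.finrank_fin_fun]

/-! ### The BCH generator and the BCH bound. -/

theorem minpoly_dvd_bchGenerator {F K : Type*} [Field F] [Field K] [Algebra F K]
    (θ : K) {δ i : ℕ} (h1 : 1 ≤ i) (h2 : i < δ) :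
    minpoly F (θ ^ i) ∣ bchGenerator F θ 1 δ := by
  unfold bchGenerator
  exact @Finset.dvd_lcm _ _ _ (_) _ (fun i => minpoly F (θ ^ i)) _
    (Finset.mem_Ico.mpr ⟨h1, by omega⟩)

theorem bchGenerator_dvd {F K : Type*} [Field F] [Field K] [Algebra F K]
    (θ : K) {δ : ℕ} {p : F[X]} (h : ∀ i, 1 ≤ i → i < δ → minpoly F (θ ^ i) ∣ p) :
    bchGenerator F θ 1 δ ∣ p := by
  unfold bchGenerator
  refine @Finset.lcm_dvd _ _ _ (_) _ _ _ fun i hi => ?_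
  rw [Finset.mem_Ico] at hi
  exact h i hi.1 (by omega)

theorem aeval_wordPoly {F K : Type*} [Field F] [Field K] [Algebra F K] {n : ℕ}
    (c : Fin n → F) (x : K) :
    aeval x (wordPoly c) = ∑ j : Fin n, algebraMap F K (c j) * x ^ (j : ℕ) := by
  simp [wordPoly]

/-- The BCH bound for a single codeword. -/
theorem le_hammingNorm_of_aeval_eq_zero {F K : Type*} [Field F] [DecidableEq F] [Field K]
    [Algebra F K] {n δ : ℕ} {θ : K} (hθ : Set.InjOn (fun j : ℕ => θ ^ j) (Set.Iio n))
    (hθ0 : θ ≠ 0) {c : Fin n → F} (hc : c ≠ 0)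
    (h : ∀ i, 1 ≤ i → i < δ → aeval (θ ^ i) (wordPoly c) = 0) : δ ≤ hammingNorm c := by
  by_contra! hlt
  obtain ⟨j₀, hj₀⟩ := Function.ne_iff.mp hc
  let s : Finset (Fin n) := {j | c j ≠ 0}
  have hs : s.card = hammingNorm c := rfl
  have hmem : j₀ ∈ s := by simpa [s] using hj₀
  -- Dual form of the Vandermonde argument: `P` has no constant term and degree below `δ`, so the
  -- vanishing at `θ, …, θ ^ (δ - 1)` kills its pairing with `c`; on the support of `c`, however,
  -- `P` is nonzero only at `j₀`.
  let P : K[X] := X * ∏ j ∈ s.erase j₀, (X - C (θ ^ (j : ℕ)))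
  have hmonic : (∏ j ∈ s.erase j₀, (X - C (θ ^ (j : ℕ)))).Monic :=
    monic_prod_of_monic _ _ fun j _ => monic_X_sub_C _
  have hdeg : P.natDegree = s.card := by
    rw [natDegree_mul X_ne_zero hmonic.ne_zero, natDegree_X, natDegree_prod_of_monic _ _
      fun j _ => monic_X_sub_C _]
    simp only [natDegree_X_sub_C, Finset.sum_const, smul_eq_mul, mul_one]
    rw [Finset.card_erase_of_mem hmem]
    have := Finset.card_pos.mpr ⟨_, hmem⟩
    omega
  have hzero : ∑ j : Fin n, algebraMap F K (c j) * P.eval (θ ^ (j : ℕ)) = 0 := by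
    simp only [eval_eq_sum_range, Finset.mul_sum]
    rw [Finset.sum_comm]
    refine Finset.sum_eq_zero fun i hi => ?_
    rw [Finset.mem_range] at hi
    rcases Nat.eq_zero_or_pos i with rfl | hpos
    · have : P.coeff 0 = 0 := by simp [P]
      simp [this]
    · have := h i hpos (by omega)
      rw [aeval_wordPoly] at this
      rw [← mul_zero (P.coeff i), ← this, Finset.mul_sum]
      refine Finset.sum_congr rfl fun j _ => ?_
      rw [← pow_mul, ← pow_mul, mul_comm i]
      ring
  rw [Finset.sum_eq_single j₀] at hzero
  · rcases mul_eq_zero.mp hzero with h0 | h0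
    · exact hj₀ (by simpa using h0)
    · simp only [P, eval_mul, eval_X, eval_prod, eval_sub, eval_C, mul_eq_zero] at h0
      rcases h0 with h0 | h0
      · exact hθ0 (eq_zero_of_pow_eq_zero h0)
      · obtain ⟨j, hj, hj0⟩ := Finset.prod_eq_zero_iff.mp h0
        refine (Finset.mem_erase.mp hj).1 (Fin.ext ?_)
        exact (hθ j₀.2 j.2 (sub_eq_zero.mp hj0)).symm
  · intro j _ hj
    by_cases hcj : c j = 0
    · simp [hcj]
    · have : P.eval (θ ^ (j : ℕ)) = 0 := by
        simp only [P, eval_mul, eval_prod]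
        rw [Finset.prod_eq_zero (Finset.mem_erase.mpr ⟨hj, by simpa [s] using hcj⟩) (by simp),
          mul_zero]
      rw [this, mul_zero]
  · simp

theorem wordPoly_one_ne_zero {F : Type*} [Field F] {n : ℕ} (hn : 0 < n) :
    wordPoly (1 : Fin n → F) ≠ 0 := fun h =>
  one_ne_zero (congrFun (wordPoly_eq_zero h) ⟨0, hn⟩)

/-- The geometric sum over powers of `θ ^ i` vanishes for `0 < i < n`. This nonzero codeword bounds
the degree of the generator and makes the minimum distance meaningful. -/
theorem bchGenerator_dvd_wordPoly_one {F K : Type*} [Field F] [Field K] [Algebra F K]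
    {n δ : ℕ} {θ : K} (hθ : orderOf θ = n) (hδ : δ ≤ n) :
    bchGenerator F θ 1 δ ∣ wordPoly (1 : Fin n → F) := by
  refine bchGenerator_dvd _ fun i h1 h2 => minpoly.dvd _ _ ?_
  rw [aeval_wordPoly]
  simp only [Pi.one_apply, map_one, one_mul]
  rw [Fin.sum_univ_eq_sum_range (fun j => (θ ^ i) ^ j) n, geom_sum_eq, ← pow_mul, mul_comm,
    pow_mul, ← hθ, pow_orderOf_eq_one, one_pow, sub_self, zero_div]
  intro h
  have := Nat.le_of_dvd h1 (orderOf_dvd_of_pow_eq_one h)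
  omega

theorem le_minDist_narrowSenseBCH {F K : Type*} [Field F] [Field K] [Algebra F K]
    {n δ : ℕ} {θ : K} (hn : 0 < n) (hθ : orderOf θ = n) (hδ : δ ≤ n) :
    δ ≤ minDist (narrowSenseBCH F n θ δ) := by
  classical
  have hθ0 : θ ≠ 0 := by
    rintro rfl
    rw [orderOf_zero] at hθ
    omega
  have hinj : Set.InjOn (fun j : ℕ => θ ^ j) (Set.Iio n) := hθ ▸ pow_injOn_Iio_orderOf
  unfold minDist
  -- `sInf ∅ = 0` in `ℕ`, so two distinct codewords must be exhibited.
  refine le_csInf ⟨_, 1, bchGenerator_dvd_wordPoly_one hθ hδ, 0, Submodule.zero_mem _,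
    fun h => wordPoly_one_ne_zero (F := F) hn (by rw [h]; simp [wordPoly]), rfl⟩ ?_
  rintro _ ⟨x, hx, y, hy, hxy, rfl⟩
  have key := le_hammingNorm_of_aeval_eq_zero (δ := δ) hinj hθ0 (c := -x + y)
    (by rwa [neg_add_eq_sub, sub_ne_zero, ne_comm])
    fun i h1 h2 => by
      have : bchGenerator F θ 1 δ ∣ wordPoly (-x + y) :=
        Submodule.add_mem _ (Submodule.neg_mem _ hx) hy
      exact aeval_eq_zero_of_dvd_aeval_eq_zero ((minpoly_dvd_bchGenerator θ h1 h2).trans this)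
        (minpoly.aeval _ _)
  rw [← hammingDist_eq_hammingNorm] at key
  convert key

theorem finrank_narrowSenseBCH {F K : Type*} [Field F] [Field K] [Algebra F K]
    {n δ : ℕ} {θ : K} (hn : 0 < n) (hθ : orderOf θ = n) (hδ : δ ≤ n) :
    Module.finrank F (narrowSenseBCH F n θ δ) + (bchGenerator F θ 1 δ).natDegree = n := by
  have hdvd := bchGenerator_dvd_wordPoly_one (F := F) hθ hδ
  have h0 := wordPoly_one_ne_zero (F := F) hn
  have hle : (bchGenerator F θ 1 δ).natDegree ≤ n :=
    (natDegree_le_of_dvd hdvd h0).trans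
      (natDegree_le_iff_degree_le.mpr (degree_wordPoly_lt _).le)
  have := finrank_cyclicCode (n := n) (ne_zero_of_dvd_ne_zero h0 hdvd) hle
  unfold narrowSenseBCH
  omega

/-! ### Conjugates over a finite field. -/

/-- Conjugates form a Galois orbit, and the Galois group consists of powers of Frobenius. -/
theorem minpoly_eq_iff_exists_pow {F K : Type*} [Field F] [Finite F] [Field K] [Algebra F K]
    [FiniteDimensional F K] {x y : K} :
    minpoly F x = minpoly F y ↔ ∃ t < Module.finrank F K, y = x ^ (Nat.card F) ^ t := by
  have := Fintype.ofFinite F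
  have : Finite K := Module.finite_of_finite F
  have happ (t : ℕ) : (FiniteField.frobeniusAlgEquivOfAlgebraic F K ^ t) x
      = x ^ (Nat.card F) ^ t := by
    rw [AlgEquiv.coe_pow, FiniteField.coe_frobeniusAlgEquivOfAlgebraic_iterate,
      Nat.card_eq_fintype_card]
  rw [eq_comm, Normal.minpoly_eq_iff_mem_orbit]
  constructor
  · rintro ⟨σ, rfl⟩
    obtain ⟨t, rfl⟩ := (FiniteField.bijective_frobeniusAlgEquivOfAlgebraic_pow F K).2 σ
    exact ⟨t, t.2, happ t⟩
  · rintro ⟨t, _, rfl⟩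
    exact ⟨FiniteField.frobeniusAlgEquivOfAlgebraic F K ^ t, happ t⟩

theorem natDegree_minpoly_eq_card {F K : Type*} [Field F] [Finite F] [Field K] [DecidableEq K]
    [Algebra F K] [FiniteDimensional F K] (x : K) :
    (minpoly F x).natDegree =
      ((Finset.range (Module.finrank F K)).image fun t => x ^ (Nat.card F) ^ t).card := by
  have : Finite K := Module.finite_of_finite F
  have hx : IsIntegral F x := IsIntegral.of_finite F x
  rw [← card_rootSet_eq_natDegree (Algebra.IsSeparable.isSeparable F x) (Normal.splits' (F := F) x),
    ← Set.toFinset_card]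
  congr 1
  ext y
  rw [Set.mem_toFinset, mem_rootSet, Finset.mem_image]
  have h1 : (minpoly F x ≠ 0 ∧ aeval y (minpoly F x) = 0) ↔ minpoly F x = minpoly F y :=
    ⟨fun h => minpoly.eq_of_irreducible_of_monic (minpoly.irreducible hx) h.2 (minpoly.monic hx),
      fun h => ⟨minpoly.ne_zero hx, h ▸ minpoly.aeval F y⟩⟩
  rw [h1, minpoly_eq_iff_exists_pow]
  simp only [Finset.mem_range, eq_comm]

/-- Distinct monic irreducibles are coprime, so their lcm is their product; `L` is a system of class
representatives. -/
theorem natDegree_bchGenerator {F K : Type*} [Field F] [Field K] [Algebra F K]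
    [FiniteDimensional F K] {θ : K} {δ : ℕ} {L : Finset ℕ}
    (hL : ∀ i ∈ L, 1 ≤ i ∧ i < δ)
    (hinj : ∀ i ∈ L, ∀ j ∈ L, minpoly F (θ ^ i) = minpoly F (θ ^ j) → i = j)
    (hsurj : ∀ i, 1 ≤ i → i < δ → ∃ j ∈ L, minpoly F (θ ^ i) = minpoly F (θ ^ j)) :
    (bchGenerator F θ 1 δ).natDegree = ∑ i ∈ L, (minpoly F (θ ^ i)).natDegree := by
  have hint (i : ℕ) : IsIntegral F (θ ^ i) := IsIntegral.of_finite F _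
  have hmon : (∏ i ∈ L, minpoly F (θ ^ i)).Monic :=
    monic_prod_of_monic _ _ fun i _ => minpoly.monic (hint i)
  rw [← natDegree_prod_of_monic _ _ fun i _ => minpoly.monic (hint i)]
  have h1 : bchGenerator F θ 1 δ ∣ ∏ i ∈ L, minpoly F (θ ^ i) :=
    bchGenerator_dvd θ fun i hi hi' => by
      obtain ⟨j, hj, h⟩ := hsurj i hi hi'
      exact h ▸ Finset.dvd_prod_of_mem (fun i => minpoly F (θ ^ i)) hj
  have h2 : ∏ i ∈ L, minpoly F (θ ^ i) ∣ bchGenerator F θ 1 δ := by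
    refine Finset.prod_dvd_of_coprime (fun i hi j hj hij => ?_)
      fun i hi => minpoly_dvd_bchGenerator θ (hL i hi).1 (hL i hi).2
    refine (minpoly.irreducible (hint i)).coprime_iff_not_dvd.mpr fun hdvd => hij ?_
    exact hinj i hi j hj (eq_of_monic_of_associated (minpoly.monic (hint i))
      (minpoly.monic (hint j)) ((minpoly.irreducible (hint i)).associated_of_dvd
        (minpoly.irreducible (hint j)) hdvd))
  exact le_antisymm (natDegree_le_of_dvd h1 hmon.ne_zero)
    (natDegree_le_of_dvd h2 (ne_zero_of_dvd_ne_zero hmon.ne_zero h1))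

/-! ### Cyclic shifts of short digit strings. -/

/-- Two integers below `q ^ (h + 1)` not divisible by `q`, whose base-`q` digit strings of
length `2 * h` are cyclic shifts of each other, are equal or differ by the half turn. -/
theorem eq_or_half_turn_of_modEq_mul_pow {q h a b t : ℕ} (hq : 2 ≤ q) (hh : 2 ≤ h)
    (ha : a < q ^ (h + 1)) (hb : b < q ^ (h + 1)) (hqa : ¬ q ∣ a) (hqb : ¬ q ∣ b)
    (ht : t < 2 * h) (hab : b ≡ a * q ^ t [MOD q ^ (2 * h) - 1]) :
    (t = 0 ∧ a = b) ∨ (t = h ∧ b / q ^ h = a % q ^ h ∧ b % q ^ h = a / q ^ h) := by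
  have hpos (k : ℕ) : 0 < q ^ k := by positivity
  have hsmall {c : ℕ} (hc : c < q ^ (h + 1)) : c < q ^ (2 * h) - 1 := by
    have h1 : q ^ (h + 1) * q ^ (h - 1) = q ^ (2 * h) := by
      rw [← pow_add]; congr 1; omega
    have h2 : 2 ≤ q ^ (h - 1) := hq.trans (Nat.le_self_pow (by omega) q)
    have h3 := Nat.mul_le_mul_left (q ^ (h + 1)) h2
    have := hpos (h + 1)
    omega
  have hM : 1 < q ^ (2 * h) := Nat.one_lt_pow (by omega) (by omega)
  -- A shift by fewer than `h` places does not wrap around, so the congruence is an equality and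
  -- forces `q ∣ b`.
  have short {a b t : ℕ} (ha : a < q ^ (h + 1)) (hb : b < q ^ (h + 1)) (hqb : ¬ q ∣ b)
      (ht0 : 1 ≤ t) (ht : t + 1 ≤ h) (hab : b ≡ a * q ^ t [MOD q ^ (2 * h) - 1]) : False := by
    have hqd : q ∣ a * q ^ t := (dvd_pow_self q (by omega)).mul_left a
    have h1 : a * q ^ t ≤ q ^ (2 * h) - 1 := by
      have h2 : a * q ^ t ≤ a * q ^ (h - 1) :=
        Nat.mul_le_mul_left a (Nat.pow_le_pow_right (by omega) (by omega))
      have h3 : (a + 1) * q ^ (h - 1) ≤ q ^ (h + 1) * q ^ (h - 1) := Nat.mul_le_mul_right _ ha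
      have h4 : q ^ (h + 1) * q ^ (h - 1) = q ^ (2 * h) := by
        rw [← pow_add]; congr 1; omega
      have := hpos (h - 1)
      rw [h4, add_mul, one_mul] at h3
      omega
    have h5 : a * q ^ t ≠ q ^ (2 * h) - 1 := by
      intro h6
      have h7 : q ∣ 1 := by
        have := Nat.dvd_sub (dvd_pow_self q (by omega : 2 * h ≠ 0)) (h6 ▸ hqd)
        rwa [Nat.sub_sub_self hM.le] at this
      have := Nat.le_of_dvd one_pos h7
      omega
    exact hqb (Nat.ModEq.eq_of_lt_of_lt hab (hsmall hb) (lt_of_le_of_ne h1 h5) ▸ hqd)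
  rcases Nat.eq_zero_or_pos t with rfl | ht0
  · rw [pow_zero, mul_one] at hab
    exact Or.inl ⟨rfl, (Nat.ModEq.eq_of_lt_of_lt hab (hsmall hb) (hsmall ha)).symm⟩
  have hone : q ^ (2 * h) ≡ 1 [MOD q ^ (2 * h) - 1] := by
    have := Nat.add_modEq_left (n := q ^ (2 * h) - 1) (a := 1)
    rwa [Nat.sub_add_cancel hM.le] at this
  rcases lt_trichotomy t h with hlt | rfl | hgt
  · exact (short ha hb hqb ht0 hlt hab).elim
  · right
    refine ⟨rfl, ?_⟩
    have h1 : a / q ^ t < q := Nat.div_lt_of_lt_mul (by rwa [← pow_succ])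
    have h2 : a % q ^ t < q ^ t := Nat.mod_lt _ (hpos t)
    have h3 : q < q ^ t := lt_self_pow₀ (by omega) (by omega)
    have h4 : a * q ^ t ≡ a % q ^ t * q ^ t + a / q ^ t [MOD q ^ (2 * t) - 1] := by
      conv_lhs => rw [← Nat.mod_add_div a (q ^ t)]
      have h5 : (a % q ^ t + q ^ t * (a / q ^ t)) * q ^ t
          = a % q ^ t * q ^ t + q ^ (2 * t) * (a / q ^ t) := by ring
      rw [h5]
      exact Nat.ModEq.add_left _ (by simpa using hone.mul_right (a / q ^ t))
    have h6 : a % q ^ t * q ^ t + a / q ^ t < q ^ (2 * t) - 1 := by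
      have h7 : (a % q ^ t + 1) * q ^ t ≤ q ^ t * q ^ t := Nat.mul_le_mul_right _ h2
      rw [← pow_add, ← two_mul, add_mul, one_mul] at h7
      omega
    have h8 := Nat.ModEq.eq_of_lt_of_lt (hab.trans h4) (hsmall hb) h6
    rw [h8]
    have h9 : a / q ^ t < q ^ t := h1.trans h3
    constructor
    · rw [mul_comm, Nat.mul_add_div (hpos t), Nat.div_eq_of_lt h9, add_zero]
    · rw [mul_comm, Nat.mul_add_mod, Nat.mod_eq_of_lt h9]
  · refine (short hb ha hqa (t := 2 * h - t) (by omega) (by omega) ?_).elim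
    have h1 := hab.mul_right (q ^ (2 * h - t))
    rw [mul_assoc, ← pow_add, Nat.add_sub_cancel' ht.le] at h1
    exact (h1.trans (by simpa using hone.mul_left a)).symm

/-! ### Degrees of minimal polynomials and of the generator. -/

section Degree

variable {F K : Type*} [Field F] [Finite F] [Field K] [Algebra F K] [FiniteDimensional F K]
  {q h : ℕ} {α : K}

theorem half_turn_of_pow_eq_pow (hq : 2 ≤ q) (hh : 2 ≤ h) (hα : orderOf α = q ^ (2 * h) - 1)
    {a : ℕ} (ha : a < q ^ (h + 1)) (hqa : ¬ q ∣ a) {s t : ℕ} (hst : s < t) (ht : t < 2 * h)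
    (he : (α ^ a) ^ q ^ s = (α ^ a) ^ q ^ t) : t - s = h ∧ a % q ^ h = a / q ^ h := by
  rw [← pow_mul, ← pow_mul] at he
  have hM : 1 < q ^ (2 * h) := Nat.one_lt_pow (by omega) (by omega)
  have hα0 : α ≠ 0 := by
    rintro rfl
    rw [orderOf_zero] at hα
    omega
  have h1 : a * q ^ s ≡ a * q ^ t [MOD q ^ (2 * h) - 1] := by
    rw [← hα]
    lift α to Kˣ using hα0.isUnit
    rw [orderOf_units, ← pow_eq_pow_iff_modEq]
    exact_mod_cast he
  have hcop : Nat.gcd (q ^ (2 * h) - 1) (q ^ s) = 1 := by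
    refine Nat.Coprime.pow_right s (Nat.Coprime.coprime_dvd_right (dvd_pow_self q
      (by omega : 2 * h ≠ 0)) ?_)
    have := (Nat.coprime_self_add_right (m := q ^ (2 * h) - 1) (n := 1)).mpr (Nat.coprime_one_right _)
    rwa [Nat.sub_add_cancel hM.le] at this
  have h2 : a ≡ a * q ^ (t - s) [MOD q ^ (2 * h) - 1] := by
    refine Nat.ModEq.cancel_right_of_coprime hcop ?_
    rwa [mul_assoc, ← pow_add, Nat.sub_add_cancel hst.le]
  rcases eq_or_half_turn_of_modEq_mul_pow hq hh ha ha hqa hqa (by omega) h2 with h3 | h3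
  · omega
  · exact ⟨h3.1, h3.2.2.symm ▸ h3.2.1.symm⟩

/-- The `2 * h` Frobenius images can repeat only after a half turn, and do so exactly when the two
halves of `a` agree. -/
theorem natDegree_minpoly_pow (hF : Nat.card F = q) (hK : Module.finrank F K = 2 * h)
    (hq : 2 ≤ q) (hh : 2 ≤ h) (hα : orderOf α = q ^ (2 * h) - 1)
    {a : ℕ} (ha : a < q ^ (h + 1)) (hqa : ¬ q ∣ a) :
    (minpoly F (α ^ a)).natDegree = if a % q ^ h = a / q ^ h then h else 2 * h := by
  classical
  rw [natDegree_minpoly_eq_card, hF, hK]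
  have hM : 1 < q ^ (2 * h) := Nat.one_lt_pow (by omega) (by omega)
  split_ifs with hif
  · have hper : (α ^ a) ^ q ^ h = α ^ a := by
      have h1 : a * q ^ h = a + orderOf α * (a / q ^ h) := by
        have h2 := Nat.mod_add_div a (q ^ h)
        rw [hif] at h2
        rw [hα]
        generalize a / q ^ h = v at h2 ⊢
        subst h2
        zify [hM.le]
        ring
      rw [← pow_mul, h1, pow_add, pow_mul, pow_orderOf_eq_one, one_pow, mul_one]
    have himg : ((Finset.range (2 * h)).image fun t => (α ^ a) ^ q ^ t)
        = (Finset.range h).image fun t => (α ^ a) ^ q ^ t := by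
      ext y
      simp only [Finset.mem_image, Finset.mem_range]
      constructor
      · rintro ⟨t, ht, rfl⟩
        rcases lt_or_ge t h with hlt | hge
        · exact ⟨t, hlt, rfl⟩
        · refine ⟨t - h, by omega, ?_⟩
          conv_rhs => rw [← Nat.add_sub_cancel' hge, pow_add, pow_mul, hper]
      · rintro ⟨t, ht, rfl⟩
        exact ⟨t, by omega, rfl⟩
    rw [himg, Finset.card_image_of_injOn, Finset.card_range]
    intro s hs t ht he
    simp only [Finset.coe_range, Set.mem_Iio] at hs ht
    by_contra hne
    rcases lt_or_gt_of_ne hne with hlt | hlt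
    · have := (half_turn_of_pow_eq_pow hq hh hα ha hqa hlt (by omega) he).1
      omega
    · have := (half_turn_of_pow_eq_pow hq hh hα ha hqa hlt (by omega) he.symm).1
      omega
  · rw [Finset.card_image_of_injOn, Finset.card_range]
    intro s hs t ht he
    simp only [Finset.coe_range, Set.mem_Iio] at hs ht
    by_contra hne
    rcases lt_or_gt_of_ne hne with hlt | hlt
    · exact hif (half_turn_of_pow_eq_pow hq hh hα ha hqa hlt ht he).2
    · exact hif (half_turn_of_pow_eq_pow hq hh hα ha hqa hlt hs he.symm).2

/-- The degree of the generator polynomial, up to the half-turn corrections. -/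
theorem natDegree_bchGenerator_add (hF : Nat.card F = q) (hK : Module.finrank F K = 2 * h)
    (hq : 2 ≤ q) (hh : 2 ≤ h) (hα : orderOf α = q ^ (2 * h) - 1) {lam : ℕ} (hlam : lam ∣ q - 1)
    {D : ℕ} (hD : lam * D < q ^ (h + 1)) :
    (bchGenerator F (α ^ lam) 1 (D + 1)).natDegree
      + h * (2 * ((Finset.Ioc 0 D).filter fun i => ¬ q ∣ i ∧
            lam * i % q ^ h < lam * i / q ^ h).card
          + ((Finset.Ioc 0 D).filter fun i => ¬ q ∣ i ∧
            lam * i % q ^ h = lam * i / q ^ h).card)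
      = 2 * h * ((Finset.Ioc 0 D).filter fun i => ¬ q ∣ i).card := by
  have hlam0 : 0 < lam := Nat.pos_of_dvd_of_pos hlam (by omega)
  have hcop : Nat.Coprime q lam := by
    refine Nat.Coprime.coprime_dvd_right hlam ?_
    have := (Nat.coprime_self_add_left (m := q - 1) (n := 1)).mpr (Nat.coprime_one_left _)
    rwa [Nat.sub_add_cancel (by omega)] at this
  have hqlam {i : ℕ} (hi : ¬ q ∣ i) : ¬ q ∣ lam * i := fun hd => hi (hcop.dvd_of_dvd_mul_left hd)
  have hlt {i : ℕ} (hi : i ≤ D) : lam * i < q ^ (h + 1) :=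
    (Nat.mul_le_mul_left lam hi).trans_lt hD
  have hqh : q < q ^ h := lt_self_pow₀ (by omega) (by omega)
  have hdivlt {a : ℕ} (ha : a < q ^ (h + 1)) : a / q ^ h < q :=
    Nat.div_lt_of_lt_mul (by rwa [← pow_succ])
  have hM : 1 < q ^ (2 * h) := Nat.one_lt_pow (by omega) (by omega)
  have hα0 : α ≠ 0 := by
    rintro rfl
    rw [orderOf_zero] at hα
    omega
  have hmodeq {i j t : ℕ} (he : (α ^ lam) ^ j = ((α ^ lam) ^ i) ^ q ^ t) :
      lam * j ≡ lam * i * q ^ t [MOD q ^ (2 * h) - 1] := by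
    rw [← pow_mul, ← pow_mul, ← pow_mul, ← mul_assoc] at he
    rw [← hα]
    lift α to Kˣ using hα0.isUnit
    rw [orderOf_units, ← pow_eq_pow_iff_modEq]
    exact_mod_cast he
  -- Of two numbers with swapped halves, keep the one with the smaller leading half, which is the
  -- smaller number.
  let L := (Finset.Ioc 0 D).filter fun i => ¬ q ∣ i ∧ lam * i / q ^ h ≤ lam * i % q ^ h
  have hLmem {i : ℕ} : i ∈ L ↔ (0 < i ∧ i ≤ D) ∧ ¬ q ∣ i ∧ lam * i / q ^ h ≤ lam * i % q ^ h := by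
    simp only [L, Finset.mem_filter, Finset.mem_Ioc]
  have hgen := natDegree_bchGenerator (F := F) (θ := α ^ lam) (δ := D + 1) (L := L)
    (fun i hi => by have := (hLmem.mp hi).1; omega)
    (by
      intro i hi j hj hij
      obtain ⟨t, ht, he⟩ := minpoly_eq_iff_exists_pow.mp hij
      rw [hF] at he
      rw [hK] at ht
      have hi := hLmem.mp hi
      have hj := hLmem.mp hj
      rcases eq_or_half_turn_of_modEq_mul_pow hq hh (hlt hi.1.2) (hlt hj.1.2) (hqlam hi.2.1)
        (hqlam hj.2.1) ht (hmodeq he) with h1 | ⟨-, h1, h2⟩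
      · exact Nat.eq_of_mul_eq_mul_left hlam0 h1.2
      · have h3 : lam * i / q ^ h = lam * i % q ^ h := by omega
        refine Nat.eq_of_mul_eq_mul_left hlam0 ?_
        rw [← Nat.div_add_mod (lam * i) (q ^ h), ← Nat.div_add_mod (lam * j) (q ^ h), h1, h2, h3])
    (by
      intro i
      -- Descent: replace `q * r` by `r`; if `u < v`, swap the halves, which decreases `lam * i` and
      -- preserves divisibility by `lam` because `q ^ h ≡ 1`.
      induction i using Nat.strong_induction_on with
      | _ i ih =>
        intro hi1 hi2
        by_cases hqi : q ∣ i
        · obtain ⟨r, rfl⟩ := hqi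
          have hr : 1 ≤ r := Nat.pos_of_ne_zero (by rintro rfl; simp at hi1)
          have hr2 : r < q * r := by nlinarith
          obtain ⟨j, hj, he⟩ := ih r hr2 hr (by omega)
          refine ⟨j, hj, he ▸ (minpoly_eq_iff_exists_pow.mpr ⟨1, by omega, ?_⟩).symm⟩
          rw [hF, pow_one, ← pow_mul _ r, mul_comm r]
        · by_cases hlow : lam * i / q ^ h ≤ lam * i % q ^ h
          · exact ⟨i, hLmem.mpr ⟨⟨hi1, by omega⟩, hqi, hlow⟩, rfl⟩
          · rw [not_le] at hlow
            have hvq : lam * i / q ^ h < q := hdivlt (hlt (by omega))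
            have hsum := Nat.div_add_mod (lam * i) (q ^ h)
            set v := lam * i / q ^ h
            set u := lam * i % q ^ h
            have hlamq : q ^ h ≡ 1 [MOD lam] := by
              have : q ≡ 1 [MOD lam] :=
                ((Nat.modEq_iff_dvd' (by omega)).mpr hlam).symm
              simpa using this.pow h
            have hdvd : lam ∣ q ^ h * u + v := by
              refine (Nat.modEq_zero_iff_dvd).mp ?_
              have h1 : q ^ h * u + v ≡ 1 * u + v [MOD lam] := (hlamq.mul_right u).add_right v
              have h2 : q ^ h * v + u ≡ 1 * v + u [MOD lam] := (hlamq.mul_right v).add_right u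
              rw [hsum] at h2
              refine h1.trans (Nat.ModEq.trans ?_ (h2.symm.trans
                (Nat.modEq_zero_iff_dvd.mpr ⟨i, rfl⟩)))
              rw [one_mul, one_mul, add_comm]
            obtain ⟨j, hj⟩ := hdvd
            have hlt' : lam * j < lam * i := by
              rw [← hj, ← hsum]
              nlinarith
            have hji : j < i := Nat.lt_of_mul_lt_mul_left hlt'
            have hdj : lam * j / q ^ h = u := by
              rw [← hj, Nat.mul_add_div (by omega), Nat.div_eq_of_lt (by omega), add_zero]
            have hmj : lam * j % q ^ h = v := by
              rw [← hj, Nat.mul_add_mod, Nat.mod_eq_of_lt (by omega)]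
            have hqj : ¬ q ∣ lam * j := by
              rw [← hj]
              intro hd
              have h1 := (Nat.dvd_add_right ((dvd_pow_self q (by omega)).mul_right u)).mp hd
              have := Nat.le_of_dvd (Nat.zero_lt_of_lt hlow) h1
              omega
            refine ⟨j, hLmem.mpr ⟨⟨Nat.pos_of_ne_zero (by rintro rfl; simp at hqj), by omega⟩,
              fun hd => hqj (hd.mul_left lam), by rw [hdj, hmj]; exact hlow.le⟩, ?_⟩
            refine (minpoly_eq_iff_exists_pow.mpr ⟨h, by omega, ?_⟩).symm
            rw [hF, ← pow_mul, ← pow_mul, ← pow_mul, ← mul_assoc, ← hsum, ← hj]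
            have h3 : (q ^ h * u + v) * q ^ h = (q ^ h * v + u) + orderOf α * u := by
              rw [hα]
              zify [hM.le]
              ring
            rw [h3, pow_add _ _ (orderOf α * u), pow_mul _ (orderOf α), pow_orderOf_eq_one,
              one_pow, mul_one])
  have hdeg (i : ℕ) (hi : i ∈ L) : (minpoly F ((α ^ lam) ^ i)).natDegree
      = if lam * i % q ^ h = lam * i / q ^ h then h else 2 * h := by
    have hi := hLmem.mp hi
    rw [← pow_mul]
    exact natDegree_minpoly_pow hF hK hq hh hα (hlt hi.1.2) (hqlam hi.2.1)
  rw [hgen, Finset.sum_congr rfl hdeg]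
  have e1 : ∑ i ∈ L, (if lam * i % q ^ h = lam * i / q ^ h then h else 2 * h)
      = ∑ i ∈ (Finset.Ioc 0 D).filter fun i => ¬ q ∣ i,
        (if lam * i / q ^ h ≤ lam * i % q ^ h then
          (if lam * i % q ^ h = lam * i / q ^ h then h else 2 * h) else 0) := by
    rw [← Finset.sum_filter, Finset.filter_filter]
  rw [e1, ← Finset.filter_filter, ← Finset.filter_filter, Finset.card_filter _ (Finset.filter _ _),
    Finset.card_filter _ (Finset.filter _ _), Finset.card_eq_sum_ones, Finset.mul_sum,
    ← Finset.sum_add_distrib, Finset.mul_sum, Finset.mul_sum, ← Finset.sum_add_distrib]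
  -- Degree plus correction is `2h + 0`, `h + h` or `0 + 2h` according as `u > v`, `u = v` or `u <
  -- v`.
  refine Finset.sum_congr rfl fun i _ => ?_
  split_ifs <;> omega

end Degree

/-! ### Counting pairs whose sum is divisible by `l`. -/

theorem card_Ioc_filter_dvd_add (l v X : ℕ) :
    ((Finset.Ioc 0 X).filter fun u => l ∣ u + v).card = (X + v) / l - v / l := by
  have h := Nat.Ioc_filter_dvd_card_eq_div (X + v) l
  have h0 := Nat.Ioc_filter_dvd_card_eq_div v l
  have hu : Finset.Ioc 0 (X + v) = Finset.Ioc 0 v ∪ Finset.Ioc v (X + v) :=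
    (Finset.Ioc_union_Ioc_eq_Ioc (by omega) (by omega)).symm
  have hd : Disjoint (Finset.Ioc 0 v) (Finset.Ioc v (X + v)) := by
    rw [Finset.disjoint_left]
    intro a ha hb
    rw [Finset.mem_Ioc] at ha hb
    omega
  rw [hu, Finset.filter_union, Finset.card_union_of_disjoint (Finset.disjoint_filter_filter hd), h0]
    at h
  have he : ((Finset.Ioc 0 X).filter fun u => l ∣ u + v).card
      = ((Finset.Ioc v (X + v)).filter fun u => l ∣ u).card := by
    refine Finset.card_bij (fun u _ => u + v) ?_ ?_ ?_
    · intro u hu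
      simp only [Finset.mem_filter, Finset.mem_Ioc] at hu ⊢
      exact ⟨by omega, hu.2⟩
    · intro a _ b _ hab
      omega
    · intro b hb
      simp only [Finset.mem_filter, Finset.mem_Ioc] at hb
      refine ⟨b - v, ?_, by omega⟩
      simp only [Finset.mem_filter, Finset.mem_Ioc]
      refine ⟨by omega, ?_⟩
      rw [Nat.sub_add_cancel (by omega)]
      exact hb.2
  omega

/-- The number of `u ∈ [1, v]` with `l ∣ u + v`, where `u < v` counts twice. -/
def symmWeight (l v : ℕ) : ℕ :=
  2 * ((v - 1 + v) / l - v / l) + if l ∣ 2 * v then 1 else 0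

theorem symmWeight_mul {l c : ℕ} (hl : 0 < l) (hc : 0 < c) :
    (symmWeight l (l * c) : ℤ) = 2 * c - 1 := by
  obtain ⟨c, rfl⟩ := Nat.exists_eq_succ_of_ne_zero hc.ne'
  unfold symmWeight
  have h1 : l * (c + 1) - 1 + l * (c + 1) = (l - 1) + l * (2 * c + 1) := by
    obtain ⟨l, rfl⟩ := Nat.exists_eq_succ_of_ne_zero hl.ne'
    have : (l + 1) * (c + 1) - 1 = l * (c + 1) + c := by
      rw [add_mul, one_mul]; omega
    rw [Nat.succ_eq_add_one, this, Nat.add_sub_cancel]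
    ring
  rw [Nat.succ_eq_add_one, h1, Nat.add_mul_div_left _ _ hl, Nat.div_eq_of_lt (by omega),
    Nat.mul_div_cancel_left _ hl, if_pos ((dvd_mul_right l _).mul_left 2)]
  push_cast
  omega

/-- Written as an increment of the `max` term, so that the sum over `v` telescopes. -/
theorem symmWeight_mul_add {l c e : ℕ} (he : 0 < e) (hel : e < l) :
    (symmWeight l (l * c + e) : ℤ)
      = 2 * c + (max 0 (2 * (e : ℤ) - l + 1) - max 0 (2 * ((e : ℤ) - 1) - l + 1)) := by
  have hl : 0 < l := by omega
  unfold symmWeight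
  have h1 : l * c + e - 1 + (l * c + e) = (2 * e - 1) + l * (2 * c) := by
    have : l * (2 * c) = l * c + l * c := by ring
    omega
  have h3 : l ∣ 2 * (l * c + e) ↔ l ∣ 2 * e := by
    rw [mul_add]
    exact Nat.dvd_add_right ((dvd_mul_right l c).mul_left 2)
  have h4 : l ∣ 2 * e ↔ 2 * e = l := by
    constructor
    · rintro ⟨k, hk⟩
      have : k < 2 := by
        by_contra! h2
        have := Nat.mul_le_mul_left l h2
        omega
      interval_cases k <;> omega
    · intro h
      rw [h]
  have h5 : (2 * e - 1) / l = if l ≤ 2 * e - 1 then 1 else 0 := by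
    split_ifs with h
    · exact Nat.div_eq_of_lt_le (by omega) (by omega)
    · exact Nat.div_eq_of_lt (by omega)
  rw [h1, Nat.add_mul_div_left _ _ hl, h5, Nat.mul_add_div hl, Nat.div_eq_of_lt hel]
  simp only [h3, h4]
  clear h1 h3 h4 h5
  split_ifs <;> push_cast <;> omega

theorem sum_symmWeight {l : ℕ} (c e : ℕ) (hel : e < l) :
    (∑ v ∈ Finset.Ioc 0 (l * c + e), symmWeight l v : ℤ)
      = l * c ^ 2 + 2 * c * e + max 0 (2 * (e : ℤ) - l + 1) := by
  have hl : 0 < l := by omega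
  suffices h : ∀ V c e : ℕ, e < l → V = l * c + e →
      (∑ v ∈ Finset.Ioc 0 V, symmWeight l v : ℤ)
        = l * c ^ 2 + 2 * c * e + max 0 (2 * (e : ℤ) - l + 1) from h _ c e hel rfl
  intro V
  induction V with
  | zero =>
    intro c e he h
    obtain ⟨h1, rfl⟩ := Nat.add_eq_zero_iff.mp h.symm
    obtain rfl : c = 0 := by
      rcases Nat.mul_eq_zero.mp h1 with h2 | h2 <;> omega
    simp
    omega
  | succ V ih =>
    intro c e he h
    rw [Finset.sum_Ioc_succ_top (Nat.zero_le V), h]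
    -- At `e = 0` the predecessor lies in the previous block, with residue `l - 1`.
    rcases Nat.eq_zero_or_pos e with rfl | he0
    · have hc : 0 < c := Nat.pos_of_ne_zero (by rintro rfl; simp at h)
      obtain ⟨c, rfl⟩ := Nat.exists_eq_succ_of_ne_zero hc.ne'
      rw [ih c (l - 1) (by omega) (by rw [Nat.succ_eq_add_one, mul_add] at h; omega), add_zero,
        symmWeight_mul hl hc, max_eq_right (by push_cast [hl]; omega),
        max_eq_left (by push_cast; omega)]
      push_cast [hl]
      ring
    · rw [ih c (e - 1) (by omega) (by omega), symmWeight_mul_add he0 he]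
      push_cast [he0]
      ring

theorem exists_mul_eq_mul_add {l q h u v : ℕ} (hl : q ≡ 1 [MOD l]) (hd : l ∣ u + v) :
    ∃ i, l * i = q ^ h * v + u := by
  have h1 : q ^ h * v + u ≡ 1 * v + u [MOD l] := by
    simpa using ((hl.pow h).mul_right v).add_right u
  rw [one_mul, add_comm v] at h1
  obtain ⟨i, hi⟩ := Nat.modEq_zero_iff_dvd.mp (h1.trans (Nat.modEq_zero_iff_dvd.mpr hd))
  exact ⟨i, hi.symm⟩

theorem dvd_mod_add_div {l q h i : ℕ} (hl : q ≡ 1 [MOD l]) :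
    l ∣ l * i % q ^ h + l * i / q ^ h := by
  have h1 : q ^ h * (l * i / q ^ h) + l * i % q ^ h ≡ 1 * (l * i / q ^ h) + l * i % q ^ h
      [MOD l] := by
    simpa using ((hl.pow h).mul_right (l * i / q ^ h)).add_right (l * i % q ^ h)
  rw [Nat.div_add_mod, one_mul, add_comm (l * i / q ^ h)] at h1
  exact Nat.modEq_zero_iff_dvd.mp (h1.symm.trans (Nat.modEq_zero_iff_dvd.mpr ⟨i, rfl⟩))

/-! ### From exponents to pairs of halves. -/

section Count

variable {q h l D U V : ℕ}

theorem mul_add_le_iff (hU : U < q ^ h) {u v : ℕ} (hu : u < q ^ h) :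
    q ^ h * v + u ≤ q ^ h * V + U ↔ v < V ∨ (v = V ∧ u ≤ U) := by
  constructor
  · intro hle
    rcases lt_trichotomy v V with hlt | rfl | hgt
    · exact Or.inl hlt
    · exact Or.inr ⟨rfl, by omega⟩
    · have := Nat.mul_le_mul_left (q ^ h) hgt
      rw [Nat.succ_eq_add_one, mul_add] at this
      omega
  · rintro (hlt | ⟨rfl, hle⟩)
    · have := Nat.mul_le_mul_left (q ^ h) hlt
      rw [Nat.succ_eq_add_one, mul_add] at this
      omega
    · omega

/-- Match `i` with the quotient `v` and remainder `u` of `l * i` by `q ^ h`. As `u < v < q`, the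
condition `¬ q ∣ i` becomes `0 < u`, and `i ≤ D` becomes a lexicographic bound. -/
theorem card_filter_mod_lt_div (hh : h ≠ 0) (hl0 : 0 < l) (hl : q ≡ 1 [MOD l])
    (hVU : l * D = q ^ h * V + U) (hU : U < q ^ h) (hVq : V < q) (hqh : q < q ^ h) :
    ((Finset.Ioc 0 D).filter fun i => ¬ q ∣ i ∧ l * i % q ^ h < l * i / q ^ h).card
      = ∑ v ∈ Finset.Ioc 0 V, ((Finset.Ioc 0 (if v < V then v - 1 else min U (V - 1))).filter
          fun u => l ∣ u + v).card := by
  rw [← Finset.card_sigma]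
  refine Finset.card_bij (fun i _ => ⟨l * i / q ^ h, l * i % q ^ h⟩) ?_ ?_ ?_
  · intro i hi
    simp only [Finset.mem_filter, Finset.mem_Ioc, Finset.mem_sigma] at hi ⊢
    obtain ⟨⟨hi0, hiD⟩, hqi, hlt⟩ := hi
    have hle := Nat.mul_le_mul_left l hiD
    rw [hVU, ← Nat.div_add_mod (l * i) (q ^ h),
      mul_add_le_iff hU (Nat.mod_lt _ (by omega))] at hle
    have hu : 0 < l * i % q ^ h := by
      refine Nat.pos_of_ne_zero fun h0 => hqi ?_
      have h1 : q ∣ l * i := (dvd_pow_self q hh).trans (Nat.dvd_of_mod_eq_zero h0)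
      refine Nat.Coprime.dvd_of_dvd_mul_left ?_ h1
      rw [Nat.Coprime, hl.gcd_eq, Nat.gcd_one_left]
    refine ⟨by omega, ⟨hu, ?_⟩, dvd_mod_add_div hl⟩
    split_ifs with h1 <;> omega
  · intro i _ j _ hij
    simp only [Sigma.mk.injEq, heq_eq_eq] at hij
    refine Nat.eq_of_mul_eq_mul_left hl0 ?_
    rw [← Nat.div_add_mod (l * i) (q ^ h), hij.1, hij.2, Nat.div_add_mod]
  · rintro ⟨v, u⟩ hvu
    simp only [Finset.mem_filter, Finset.mem_Ioc, Finset.mem_sigma] at hvu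
    obtain ⟨⟨hv0, hvV⟩, ⟨hu0, hu⟩, hd⟩ := hvu
    obtain ⟨i, hi⟩ := exists_mul_eq_mul_add (h := h) hl hd
    have huv : u < v ∧ (v < V ∨ (v = V ∧ u ≤ U)) := by
      split_ifs at hu with h1 <;> omega
    have hdiv : l * i / q ^ h = v := by
      rw [hi, Nat.mul_add_div (by omega), Nat.div_eq_of_lt (by omega), add_zero]
    have hmod : l * i % q ^ h = u := by
      rw [hi, Nat.mul_add_mod, Nat.mod_eq_of_lt (by omega)]
    refine ⟨i, ?_, by rw [hdiv, hmod]⟩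
    simp only [Finset.mem_filter, Finset.mem_Ioc]
    refine ⟨⟨Nat.pos_of_ne_zero ?_, ?_⟩, fun hqi => ?_, by rw [hdiv, hmod]; exact huv.1⟩
    · rintro rfl
      omega
    · refine Nat.le_of_mul_le_mul_left ?_ hl0
      rw [hVU, hi]
      exact (mul_add_le_iff hU (by omega)).mpr huv.2
    · have h1 : q ∣ q ^ h * v + u := hi ▸ hqi.mul_left l
      have h2 := (Nat.dvd_add_right ((dvd_pow_self q hh).mul_right v)).mp h1
      have := Nat.le_of_dvd hu0 h2
      omega

theorem card_filter_mod_eq_div (hh : h ≠ 0) (hl0 : 0 < l) (hl : q ≡ 1 [MOD l])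
    (hVU : l * D = q ^ h * V + U) (hU : U < q ^ h) (hVq : V < q) (hqh : q < q ^ h) :
    ((Finset.Ioc 0 D).filter fun i => ¬ q ∣ i ∧ l * i % q ^ h = l * i / q ^ h).card
      = ((Finset.Ioc 0 V).filter fun v => l ∣ 2 * v ∧ (v < V ∨ V ≤ U)).card := by
  refine Finset.card_bij (fun i _ => l * i / q ^ h) ?_ ?_ ?_
  · intro i hi
    simp only [Finset.mem_filter, Finset.mem_Ioc] at hi ⊢
    obtain ⟨⟨hi0, hiD⟩, hqi, heq⟩ := hi
    have hle := Nat.mul_le_mul_left l hiD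
    rw [hVU, ← Nat.div_add_mod (l * i) (q ^ h),
      mul_add_le_iff hU (Nat.mod_lt _ (by omega))] at hle
    have hsum := Nat.div_add_mod (l * i) (q ^ h)
    have hd := dvd_mod_add_div (h := h) (i := i) hl
    rw [heq, ← two_mul] at hd
    refine ⟨⟨Nat.pos_of_ne_zero fun h0 => ?_, by omega⟩, hd, by omega⟩
    rw [heq, h0, mul_zero, add_zero] at hsum
    have := Nat.mul_pos hl0 hi0
    omega
  · intro i hi j hj hij
    simp only [Finset.mem_filter] at hi hj
    refine Nat.eq_of_mul_eq_mul_left hl0 ?_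
    have h1 := Nat.div_add_mod (l * i) (q ^ h)
    have h2 := Nat.div_add_mod (l * j) (q ^ h)
    rw [hi.2.2, hij] at h1
    rw [hj.2.2] at h2
    exact h1.symm.trans h2
  · intro v hv
    simp only [Finset.mem_filter, Finset.mem_Ioc] at hv
    obtain ⟨⟨hv0, hvV⟩, hd, hv⟩ := hv
    obtain ⟨i, hi⟩ := exists_mul_eq_mul_add (h := h) (u := v) (v := v) hl (by rwa [← two_mul])
    have hdiv : l * i / q ^ h = v := by
      rw [hi, Nat.mul_add_div (by omega), Nat.div_eq_of_lt (by omega), add_zero]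
    have hmod : l * i % q ^ h = v := by
      rw [hi, Nat.mul_add_mod, Nat.mod_eq_of_lt (by omega)]
    refine ⟨i, ?_, hdiv⟩
    simp only [Finset.mem_filter, Finset.mem_Ioc]
    refine ⟨⟨Nat.pos_of_ne_zero ?_, ?_⟩, fun hqi => ?_, by rw [hdiv, hmod]⟩
    · rintro rfl
      omega
    · refine Nat.le_of_mul_le_mul_left ?_ hl0
      rw [hVU, hi]
      exact (mul_add_le_iff hU (by omega)).mpr (by omega)
    · have h1 : q ∣ q ^ h * v + v := hi ▸ hqi.mul_left l
      have h2 := (Nat.dvd_add_right ((dvd_pow_self q hh).mul_right v)).mp h1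
      have := Nat.le_of_dvd hv0 h2
      omega

theorem two_mul_card_add_card (hh : h ≠ 0) (hl0 : 0 < l) (hl : q ≡ 1 [MOD l])
    (hVU : l * D = q ^ h * V + U) (hU : U < q ^ h) (hVq : V < q) (hqh : q < q ^ h) :
    2 * ((Finset.Ioc 0 D).filter fun i => ¬ q ∣ i ∧ l * i % q ^ h < l * i / q ^ h).card
      + ((Finset.Ioc 0 D).filter fun i => ¬ q ∣ i ∧ l * i % q ^ h = l * i / q ^ h).card
    = if V ≤ U then ∑ v ∈ Finset.Ioc 0 V, symmWeight l v
      else ∑ v ∈ Finset.Ioc 0 (V - 1), symmWeight l v + 2 * ((U + V) / l - V / l) := by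
  rw [card_filter_mod_lt_div hh hl0 hl hVU hU hVq hqh,
    card_filter_mod_eq_div hh hl0 hl hVU hU hVq hqh, Finset.card_filter, Finset.mul_sum,
    ← Finset.sum_add_distrib]
  simp only [card_Ioc_filter_dvd_add]
  have hterm {v : ℕ} (hv : v < V) :
      2 * (((if v < V then v - 1 else min U (V - 1)) + v) / l - v / l)
        + (if l ∣ 2 * v ∧ (v < V ∨ V ≤ U) then 1 else 0) = symmWeight l v := by
    simp only [hv, true_or, and_true, if_true]
    rfl
  split_ifs with hle
  · refine Finset.sum_congr rfl fun v hv => ?_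
    rw [Finset.mem_Ioc] at hv
    rcases hv.2.lt_or_eq with hlt | rfl
    · exact hterm hlt
    · simp only [lt_irrefl, hle, or_true, and_true, if_false]
      rw [min_eq_right (by omega)]
      rfl
  · obtain ⟨W, rfl⟩ := Nat.exists_eq_succ_of_ne_zero (by omega : V ≠ 0)
    rw [Nat.succ_eq_add_one, Finset.sum_Ioc_succ_top (Nat.zero_le W), Nat.add_sub_cancel]
    congr 1
    · refine Finset.sum_congr rfl fun v hv => ?_
      rw [Finset.mem_Ioc] at hv
      exact hterm (by omega)
    · rw [if_neg (lt_irrefl _), if_neg (by omega), min_eq_left (by omega), add_zero]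

end Count

/-! ### Closed forms of the pair count. -/

/-- The number of pairs `(u, v)` of positive integers with `l ∣ u + v` whose larger entry is less
than `V`, or equal to `V` with the smaller entry at most `U`. -/
def pairCount (l V U : ℕ) : ℕ :=
  if V ≤ U then ∑ v ∈ Finset.Ioc 0 V, symmWeight l v
  else ∑ v ∈ Finset.Ioc 0 (V - 1), symmWeight l v + 2 * ((U + V) / l - V / l)

/-- Truncating the last row at `U` loses nothing: after `U`, the next `u` with `l ∣ u + V` is `U + l
> V`. -/
theorem pairCount_of_lt {l c e ρ : ℕ} (he : e < l) (hc : c < ρ) :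
    (pairCount l (l * c + e) (l * ρ - e) : ℤ)
      = l * c ^ 2 + 2 * c * e + max 0 (2 * (e : ℤ) - l + 1) := by
  have hl : 0 < l := by omega
  have hρ : l * (c + 1) ≤ l * ρ := Nat.mul_le_mul_left l hc
  rw [mul_add, mul_one] at hρ
  unfold pairCount
  split_ifs with h
  · push_cast
    exact sum_symmWeight c e he
  · have hρc : ρ = c + 1 := by
      by_contra hne
      have := Nat.mul_le_mul_left l (show c + 2 ≤ ρ by omega)
      rw [mul_add] at this
      omega
    subst hρc
    have h0 := mul_add l c 1
    have h1 : l * (c + 1) - e + (l * c + e) = l * (c + (c + 1)) := by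
      rw [mul_add l c, mul_add l c, mul_one]
      omega
    have h2 : l * c + e - 1 = l * c + (e - 1) := by omega
    rw [h1, h2, Nat.mul_div_cancel_left _ hl, Nat.mul_add_div hl, Nat.div_eq_of_lt he, add_zero,
      Nat.add_sub_cancel_left]
    push_cast
    rw [sum_symmWeight c (e - 1) (by omega), max_eq_right (by omega), max_eq_right (by omega)]
    push_cast [show 1 ≤ e by omega]
    ring

/-- Here the last row is truncated to the `ρ` values `l - e, 2l - e, …, lρ - e`, each counted twice.
-/
theorem pairCount_of_le {l c e ρ : ℕ} (he0 : 1 ≤ e) (he : e < l) (hρ0 : 1 ≤ ρ) (hc : ρ ≤ c) :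
    (pairCount l (l * c + e) (l * ρ - e) : ℤ)
      = l * c ^ 2 + 2 * c * (e - 1) + max 0 (2 * (e : ℤ) - l - 1) + 2 * ρ := by
  have hl : 0 < l := by omega
  have hρ : l * ρ ≤ l * c := Nat.mul_le_mul_left l hc
  have hlρ : l ≤ l * ρ := Nat.le_mul_of_pos_right l hρ0
  unfold pairCount
  have h1 : l * ρ - e + (l * c + e) = l * (c + ρ) := by
    rw [mul_add l c]
    omega
  have h2 : l * c + e - 1 = l * c + (e - 1) := by omega
  rw [if_neg (by omega), h1, h2, Nat.mul_div_cancel_left _ hl, Nat.mul_add_div hl,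
    Nat.div_eq_of_lt he, add_zero, Nat.add_sub_cancel_left]
  push_cast
  rw [sum_symmWeight c (e - 1) (by omega)]
  push_cast [he0]
  ring_nf

theorem pairCount_mul_of_le {l c R : ℕ} (hl : 0 < l) (hc : c ≤ R) :
    (pairCount l (l * c) (l * R) : ℤ) = l * c ^ 2 := by
  unfold pairCount
  rw [if_pos (Nat.mul_le_mul_left l hc)]
  have := sum_symmWeight c 0 hl
  rw [add_zero] at this
  push_cast at this ⊢
  rw [this, max_eq_left (by omega)]
  ring

theorem pairCount_mul_of_lt {l c R : ℕ} (hl : 0 < l) (hc : R < c) :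
    (pairCount l (l * c) (l * R) : ℤ) = l * c ^ 2 - 2 * c + 1 + 2 * R := by
  unfold pairCount
  have h := Nat.mul_le_mul_left l hc
  rw [Nat.succ_eq_add_one, mul_add] at h
  rw [if_neg (by omega)]
  obtain ⟨c, rfl⟩ := Nat.exists_eq_succ_of_ne_zero (by omega : c ≠ 0)
  have h1 : l * c.succ - 1 = l * c + (l - 1) := by
    rw [Nat.succ_eq_add_one, mul_add]
    omega
  rw [h1, ← mul_add, Nat.mul_div_cancel_left _ hl, Nat.mul_div_cancel_left _ hl,
    Nat.add_sub_cancel]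
  push_cast
  rw [sum_symmWeight c (l - 1) (by omega), max_eq_right (by omega)]
  push_cast [hl]
  ring

/-! ### Digits, ceilings and floors. -/

theorem sum_digits_lt {q : ℕ} (hq : 1 ≤ q) {d : ℕ → ℕ} :
    ∀ {h : ℕ}, (∀ j < h, d j ≤ q - 1) → ∑ j ∈ Finset.range h, d j * q ^ j < q ^ h
  | 0, _ => by simp
  | h + 1, hd => by
    have ih := sum_digits_lt hq (h := h) fun j hj => hd j (by omega)
    have h1 : (d h + 1) * q ^ h ≤ q * q ^ h :=
      Nat.mul_le_mul_right _ (by have := hd h (by omega); omega)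
    rw [Finset.sum_range_succ, pow_succ']
    rw [add_mul, one_mul] at h1
    omega

theorem sum_digits_mod {q h : ℕ} (hq : 1 ≤ q) (hh : 1 ≤ h) {d : ℕ → ℕ} (hd : d 0 ≤ q - 1) :
    (∑ j ∈ Finset.range h, d j * q ^ j) % q = d 0 := by
  obtain ⟨h, rfl⟩ := Nat.exists_eq_succ_of_ne_zero (by omega : h ≠ 0)
  have h1 : q ∣ ∑ j ∈ Finset.range h, d (j + 1) * q ^ (j + 1) :=
    Finset.dvd_sum fun j _ => (dvd_pow_self q (by omega)).mul_left _
  rw [Nat.succ_eq_add_one, Finset.sum_range_succ', pow_zero, mul_one, Nat.add_mod,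
    Nat.mod_eq_zero_of_dvd h1, zero_add, Nat.mod_mod, Nat.mod_eq_of_lt (by omega)]

theorem card_filter_not_dvd (q D : ℕ) :
    ((Finset.Ioc 0 D).filter fun i => ¬ q ∣ i).card + D / q = D := by
  have h1 := Finset.card_filter_add_card_filter_not (s := Finset.Ioc 0 D) fun i => q ∣ i
  rw [Nat.Ioc_filter_dvd_card_eq_div, Nat.card_Ioc] at h1
  omega

/-- This identifies `δbar` with the number of non-multiples of `q` in `[1, D]`. -/
theorem ceil_mul_sub_one_div {q : ℕ} (hq : 1 ≤ q) (D : ℕ) :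
    ⌈(D : ℚ) * ((q : ℚ) - 1) / q⌉ = (D : ℤ) - (D / q : ℕ) := by
  have hq0 : (q : ℚ) ≠ 0 := by positivity
  have h1 : (D : ℚ) * ((q : ℚ) - 1) / q = ((D : ℤ) : ℚ) + -(((D : ℤ) : ℚ) / (q : ℚ)) := by
    push_cast
    field_simp
    ring
  rw [h1, Int.ceil_intCast_add, Int.ceil_neg, Rat.floor_intCast_div_natCast]
  push_cast
  ring

theorem floor_half (l : ℕ) : ⌊(l : ℚ) / 2⌋ = (l : ℤ) / 2 := by
  have := Rat.floor_intCast_div_natCast (l : ℤ) 2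
  rwa [Int.cast_natCast, Nat.cast_ofNat, Nat.cast_ofNat] at this

theorem floor_mul_div_mul {l w : ℕ} (hl : 0 < l) (x : ℤ) :
    ⌊(x : ℚ) * l / (l * w)⌋ = x / w := by
  have h1 : (l : ℚ) ≠ 0 := by positivity
  rw [mul_comm (x : ℚ), mul_div_mul_left _ _ h1, Rat.floor_intCast_div_natCast]

theorem succ_le_length {q h l n D : ℕ} (hq : 2 ≤ q) (hh : 2 ≤ h) (hl : l ∣ q - 1)
    (hn : n = (q ^ (2 * h) - 1) / l) (hD : l * D < q ^ (h + 1)) :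
    l ∣ q ^ (2 * h) - 1 ∧ D + 1 ≤ n := by
  have hl0 : 0 < l := Nat.pos_of_dvd_of_pos hl (by omega)
  have hdvd : l ∣ q ^ (2 * h) - 1 := hl.trans (by simpa using Nat.sub_dvd_pow_sub_pow q 1 (2 * h))
  refine ⟨hdvd, ?_⟩
  rw [hn, Nat.le_div_iff_mul_le hl0, mul_comm, mul_add, mul_one]
  have h1 : l ≤ q - 1 := Nat.le_of_dvd (by omega) hl
  have h2 : q ≤ q ^ (h + 1) := Nat.le_self_pow (by omega) q
  have h3 : q ^ (h + 1) * q ≤ q ^ (2 * h) := by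
    rw [← pow_succ]
    exact Nat.pow_le_pow_right (by omega) (by omega)
  have h4 := Nat.mul_le_mul_left (q ^ (h + 1)) hq
  omega

/-! ### The dimension formula and its cases. -/

/-- One formula for all cases; only `pairCount` remains to be evaluated. -/
theorem narrowSenseBCH_dimension {F K : Type*} [Field F] [Finite F] [Field K] [Algebra F K]
    [FiniteDimensional F K]
    {q h l n D V U : ℕ} (hF : Nat.card F = q) (hK : Module.finrank F K = 2 * h) (hq : 2 ≤ q)
    (hh : 2 ≤ h) (hl : l ∣ q - 1) (hn : n = (q ^ (2 * h) - 1) / l) {α : K}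
    (hα : orderOf α = q ^ (2 * h) - 1) (hD : l * D < q ^ (h + 1))
    (hVU : l * D = q ^ h * V + U) (hU : U < q ^ h) :
    (Module.finrank F (narrowSenseBCH F n (α ^ l) (D + 1)) : ℚ)
      = n - (2 * h : ℕ) * (⌈(D : ℚ) * ((q : ℚ) - 1) / q⌉ : ℤ)
        + (2 * h : ℕ) * ((pairCount l V U : ℤ) : ℚ) / 2 := by
  have hl0 : 0 < l := Nat.pos_of_dvd_of_pos hl (by omega)
  obtain ⟨hdvd, hlen⟩ := succ_le_length hq hh hl hn hD
  have hθ : orderOf (α ^ l) = n := by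
    rw [orderOf_pow_of_dvd hl0.ne' (hα ▸ hdvd), hα, hn]
  have hVq : V < q := by
    refine Nat.lt_of_mul_lt_mul_left (a := q ^ h) ?_
    rw [← pow_succ]
    omega
  have h1 := finrank_narrowSenseBCH (F := F) (by omega) hθ hlen
  have h2 := natDegree_bchGenerator_add hF hK hq hh hα hl hD
  rw [two_mul_card_add_card (by omega) hl0 ((Nat.modEq_iff_dvd' (by omega)).mpr hl).symm hVU hU hVq
    (lt_self_pow₀ (by omega) (by omega))] at h2
  change _ + h * pairCount l V U = _ at h2
  have h3 := card_filter_not_dvd q D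
  have h4 := ceil_mul_sub_one_div (by omega : 1 ≤ q) D
  rw [h4]
  generalize ((Finset.Ioc 0 D).filter fun i => ¬ q ∣ i).card = S at h2 h3
  generalize D / q = T at h3 ⊢
  have h1' := congrArg (Nat.cast : ℕ → ℚ) h1
  have h2' := congrArg (Nat.cast : ℕ → ℚ) h2
  have h3' := congrArg (Nat.cast : ℕ → ℚ) h3
  push_cast at h1' h2' h3' ⊢
  linear_combination h1' - h2' - 2 * (h : ℚ) * h3'

theorem le_minDist_of_mul_lt {F K : Type*} [Field F] [Field K] [Algebra F K]
    {q h l n D : ℕ} (hq : 2 ≤ q) (hh : 2 ≤ h) (hl : l ∣ q - 1) (hn : n = (q ^ (2 * h) - 1) / l)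
    {α : K} (hα : orderOf α = q ^ (2 * h) - 1) (hD : l * D < q ^ (h + 1)) :
    D + 1 ≤ minDist (narrowSenseBCH F n (α ^ l) (D + 1)) := by
  have hl0 : 0 < l := Nat.pos_of_dvd_of_pos hl (by omega)
  obtain ⟨hdvd, hlen⟩ := succ_le_length hq hh hl hn hD
  refine le_minDist_narrowSenseBCH (by omega) ?_ hlen
  rw [orderOf_pow_of_dvd hl0.ne' (hα ▸ hdvd), hα, hn]

/-- The remainder is taken in `[1, w]` because `ε` and `ϑ` are floors in `δ - 2`, hence quotients of
`R - 1`. -/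
theorem exists_quotient_remainder {l w R : ℕ} (hR : 1 ≤ R) (hRw : R ≤ l * w) :
    ∃ e ρ, e < l ∧ 1 ≤ ρ ∧ ρ ≤ w ∧ R = e * w + ρ ∧ ((R : ℤ) - 1) / w = e := by
  have hw : 0 < w := Nat.pos_of_ne_zero (by rintro rfl; omega)
  have h1 := Nat.div_add_mod (R - 1) w
  have h2 := Nat.mod_lt (R - 1) hw
  refine ⟨(R - 1) / w, (R - 1) % w + 1, ?_, by omega, by omega, ?_, ?_⟩
  · refine Nat.div_lt_of_lt_mul ?_
    rw [mul_comm]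
    omega
  · rw [mul_comm]
    omega
  · rw [← Nat.cast_one, ← Nat.cast_sub hR]
    rfl

/-- The units digit of `e * (q ^ h - 1) / l + ρ`. -/
theorem mul_add_mod_eq {q h l w r e ρ : ℕ} (hq : 2 ≤ q) (hh : 1 ≤ h) (hr : q - 1 = l * r)
    (hw : q ^ h - 1 = l * w) (he : e < l) (hρ : ρ < r + 1) : (e * w + ρ) % q = e * r + ρ := by
  have hqh : 1 ≤ q ^ h := Nat.one_le_pow _ _ (by omega)
  have hcop : IsCoprime (q : ℤ) l := by
    refine ⟨1, -r, ?_⟩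
    zify [show 1 ≤ q by omega] at hr
    linear_combination hr
  -- `w ≡ r` modulo `q`, since `l * (w - r) = q ^ h - q` and `l` is prime to `q`.
  have h1 : (q : ℤ) ∣ l * ((w : ℤ) - r) := by
    zify [hqh, show 1 ≤ q by omega] at hr hw
    have h2 : (l : ℤ) * (w - r) = q ^ h - q := by linear_combination hr - hw
    rw [h2]
    exact dvd_sub (dvd_pow_self _ (by omega)) dvd_rfl
  have h3 : e * w + ρ ≡ e * r + ρ [MOD q] := by
    rw [← Int.natCast_modEq_iff]
    push_cast
    refine Int.ModEq.symm ((Int.modEq_iff_dvd).mpr ?_)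
    have h4 := (hcop.dvd_of_dvd_mul_left h1).mul_left (e : ℤ)
    rwa [show (e : ℤ) * w + ρ - (e * r + ρ) = e * (w - r) by ring]
  have h5 : e * r + r ≤ l * r := by
    have := Nat.mul_le_mul_right r he
    rwa [Nat.succ_eq_add_one, add_mul, one_mul] at this
  exact Nat.mod_eq_of_modEq h3 (by omega)

theorem theorem3
    {F K : Type*} [Field F] [Finite F] [Field K] [Algebra F K]
    -- `F` is the field with `q` elements, `K` its extension of degree `m = 2h`
    (q m h : ℕ) (hq : Nat.card F = q) (hK : Module.finrank F K = m)
    (hm : m = 2 * h) (hm4 : 4 ≤ m)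
    (lam n : ℕ) (hlam0 : 0 < lam) (hlam : lam ∣ q - 1) (hn : n = (q ^ m - 1) / lam)
    -- `α` is a primitive element of `K`
    (α : Kˣ) (hα : ∀ x : Kˣ, x ∈ Subgroup.zpowers α)
    (δ : ℕ) (hδ1 : (1 : ℚ) ≤ (δ : ℚ) - 1)
    (hδ2 : (δ : ℚ) - 1 ≤ ((q : ℚ) ^ (h + 1) - 1) / (lam : ℚ))
    -- `d 0, …, d h` are the `q`-adic digits of `δ - 1`
    (d : ℕ → ℕ) (hd : ∀ j ≤ h, d j ≤ q - 1)
    (hdsum : δ - 1 = ∑ j ∈ Finset.range (h + 1), d j * q ^ j)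
    (δbar : ℤ) (hδbar : δbar = ⌈((δ : ℚ) - 1) * ((q : ℚ) - 1) / (q : ℚ)⌉)
    (k : ℕ) (hk : k = Module.finrank F (narrowSenseBCH F n ((α : K) ^ lam) δ)) :
    δ ≤ minDist (narrowSenseBCH F n ((α : K) ^ lam) δ) ∧
    -- (i)
    (δ ≤ q ^ h + 1 → ∀ ε : ℤ, ε = ⌊((δ : ℚ) - 2) * (lam : ℚ) / ((q : ℚ) ^ h - 1)⌋ →
      (ε < ⌊(lam : ℚ) / 2⌋ →
        (k : ℚ) = n - m * δbar) ∧
      (⌊(lam : ℚ) / 2⌋ ≤ ε → ε < (lam : ℤ) →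
        (k : ℚ) = n - m * δbar + m * (ε - ((lam : ℚ) - 1) / 2)) ∧
      (ε = (lam : ℤ) →
        (k : ℚ) = n - m * δbar + m * (((lam : ℚ) - 1) / 2))) ∧
    -- (ii)
    (q ^ h + 2 ≤ δ → (d h : ℚ) < ((q : ℚ) - 1) / (lam : ℚ) →
      ∀ ϑ : ℤ, ϑ = ⌊((δ : ℚ) - 2 - d h * (q : ℚ) ^ h) * (lam : ℚ) / ((q : ℚ) ^ h - 1)⌋ →
      (δ ≤ d h * q ^ h + d h →
        (k : ℚ) = n - m * δbar
          + m * (((lam : ℚ) * (d h : ℚ) ^ 2 + 2 * ((d 0 : ℚ) - d h) + 1) / 2)) ∧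
      (d h * q ^ h + d h < δ →
        (δ : ℚ) ≤ d h * (q : ℚ) ^ h + ((q : ℚ) ^ h - 1) / lam + 1 →
        (k : ℚ) = n - m * δbar + m * ((lam : ℚ) * (d h : ℚ) ^ 2 / 2)) ∧
      ((d h : ℚ) * (q : ℚ) ^ h + ϑ * ((q : ℚ) ^ h - 1) / lam + 1 < δ →
        (δ : ℚ) ≤ d h * (q : ℚ) ^ h + ϑ * ((q : ℚ) ^ h - 1) / lam + d h + 1 →
        1 ≤ ϑ → (ϑ : ℚ) ≤ (lam : ℚ) / 2 →
        (k : ℚ) = n - m * δbar + m * ((lam : ℚ) * (d h : ℚ) ^ 2 / 2)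
          + m * (((ϑ : ℚ) - 1) * d h + d 0 - ϑ * ((q : ℚ) - 1) / lam)) ∧
      ((d h : ℚ) * (q : ℚ) ^ h + ϑ * ((q : ℚ) ^ h - 1) / lam + 1 < δ →
        (δ : ℚ) ≤ d h * (q : ℚ) ^ h + ϑ * ((q : ℚ) ^ h - 1) / lam + d h + 1 →
        (lam : ℚ) / 2 < ϑ →
        (k : ℚ) = n - m * δbar + m * ((lam : ℚ) * (d h : ℚ) ^ 2 / 2)
          + m * (((ϑ : ℚ) - 1) * d h + d 0 - ϑ * ((q : ℚ) - 1) / lam)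
          + m * ((ϑ : ℚ) - ((lam : ℚ) + 1) / 2)) ∧
      ((d h : ℚ) * (q : ℚ) ^ h + ϑ * ((q : ℚ) ^ h - 1) / lam + d h + 1 < δ →
        1 ≤ ϑ → (ϑ : ℚ) < (lam : ℚ) / 2 →
        (k : ℚ) = n - m * δbar + m * ((lam : ℚ) * (d h : ℚ) ^ 2 / 2) + m * (ϑ * (d h : ℚ))) ∧
      ((d h : ℚ) * (q : ℚ) ^ h + ϑ * ((q : ℚ) ^ h - 1) / lam + d h + 1 < δ →
        (lam : ℚ) / 2 ≤ ϑ →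
        (k : ℚ) = n - m * δbar + m * ((lam : ℚ) * (d h : ℚ) ^ 2 / 2) + m * (ϑ * (d h : ℚ))
          + m * ((ϑ : ℚ) - ((lam : ℚ) - 1) / 2))) ∧
    -- (iii)
    (q ^ h + 2 ≤ δ → (d h : ℚ) = ((q : ℚ) - 1) / (lam : ℚ) →
      (δ ≤ d h * q ^ h + d h →
        (k : ℚ) = n - m * δbar
          + m * (((lam : ℚ) * (d h : ℚ) ^ 2 + 2 * ((d 0 : ℚ) - d h) + 1) / 2)) ∧
      (d h * q ^ h + d h < δ →
        (k : ℚ) = n - m * δbar + m * ((lam : ℚ) * (d h : ℚ) ^ 2 / 2))) := by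
  subst hm
  have hh : 2 ≤ h := by omega
  have : FiniteDimensional F K := Module.finite_of_finrank_pos (by omega)
  have : Finite K := Module.finite_of_finite F
  have hq2 : 2 ≤ q := hq ▸ Finite.one_lt_card
  have hord : orderOf (α : K) = q ^ (2 * h) - 1 := by
    rw [orderOf_units, orderOf_eq_card_of_forall_mem_zpowers hα, Nat.card_units,
      Module.natCard_eq_pow_finrank (K := F), hq, hK]
  have hlamQ : (0 : ℚ) < lam := by exact_mod_cast hlam0
  have hδ2' : 2 ≤ δ := by
    have : (2 : ℚ) ≤ δ := by linarith
    exact_mod_cast this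
  obtain ⟨D, rfl⟩ : ∃ D, δ = D + 1 := ⟨δ - 1, by omega⟩
  rw [Nat.add_sub_cancel] at hdsum
  have hD : lam * D < q ^ (h + 1) := by
    rw [le_div_iff₀ hlamQ] at hδ2
    push_cast at hδ2
    have : (lam : ℚ) * D < q ^ (h + 1) := by linarith
    exact_mod_cast this
  obtain ⟨r, hr⟩ := hlam
  have hw' : lam ∣ q ^ h - 1 :=
    (Dvd.intro _ hr.symm).trans (by simpa using Nat.sub_dvd_pow_sub_pow q 1 h)
  obtain ⟨w, hw⟩ := hw'
  have hp : q < q ^ h := lt_self_pow₀ (by omega) (by omega)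
  have hw0 : 0 < w := Nat.pos_of_ne_zero (by rintro rfl; omega)
  set R := ∑ j ∈ Finset.range h, d j * q ^ j with hRdef
  have hRp : R < q ^ h := sum_digits_lt (by omega) fun j hj => hd j hj.le
  have hRmod : R % q = d 0 := sum_digits_mod (by omega) (by omega) (hd 0 (by omega))
  have hDR : D = d h * q ^ h + R := by
    rw [hdsum, Finset.sum_range_succ, add_comm]
  generalize d h = c at hDR ⊢
  generalize d 0 = d₀ at hRmod ⊢
  clear_value R
  have hlD : lam * D = q ^ h * (lam * c) + lam * R := by rw [hDR]; ring
  have hcr : lam * c ≤ lam * r := by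
    have h1 : q ^ h * (lam * c) < q ^ h * q := by
      rw [← pow_succ]
      omega
    have := Nat.lt_of_mul_lt_mul_left h1
    omega
  have hrQ : (q : ℚ) - 1 = lam * r := by
    have := congrArg (Nat.cast : ℕ → ℚ) hr
    rw [Nat.cast_sub (by omega)] at this
    exact_mod_cast this
  have hwQ : (q : ℚ) ^ h - 1 = lam * w := by
    have := congrArg (Nat.cast : ℕ → ℚ) hw
    rw [Nat.cast_sub (by omega)] at this
    exact_mod_cast this
  have hdim {V U : ℕ} (hVU : lam * D = q ^ h * V + U) (hU : U < q ^ h) :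
      (k : ℚ) = n - (2 * h : ℕ) * δbar + (2 * h : ℕ) * ((pairCount lam V U : ℤ) : ℚ) / 2 := by
    rw [hk, hδbar, Nat.cast_add_one D, add_sub_cancel_right]
    exact narrowSenseBCH_dimension hq hK hq2 hh (Dvd.intro _ hr.symm) hn hord hD hVU hU
  -- `lam * R = e * (q ^ h - 1) + lam * ρ`, so `e` carries into the leading half.
  have hsplit {e ρ : ℕ} (he : e < lam) (hρ1 : 1 ≤ ρ) (hρw : ρ ≤ w) (hR : R = e * w + ρ) :
      lam * D = q ^ h * (lam * c + e) + (lam * ρ - e) ∧ lam * ρ - e < q ^ h := by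
    have h1 : lam ≤ lam * ρ := Nat.le_mul_of_pos_right _ hρ1
    have h2 : lam * ρ ≤ lam * w := Nat.mul_le_mul_left _ hρw
    refine ⟨?_, by omega⟩
    rw [hlD, hR]
    have hw2 : q ^ h = lam * w + 1 := by omega
    zify [show e ≤ lam * ρ by omega] at hw2 ⊢
    rw [hw2]
    ring
  have hfloor : ⌊((D : ℚ) + 1 - 2 - c * (q : ℚ) ^ h) * (lam : ℚ) / ((q : ℚ) ^ h - 1)⌋
      = ((R : ℤ) - 1) / w := by
    rw [hwQ, ← floor_mul_div_mul hlam0]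
    congr 3
    rw [hDR]
    push_cast
    ring
  have hRw : R ≤ lam * w := by omega
  have hDQ : (D : ℚ) = c * (q : ℚ) ^ h + R := by exact_mod_cast hDR
  have hlow (h1 : D + 1 ≤ c * q ^ h + c) :
      (k : ℚ) = n - (2 * h : ℕ) * δbar
        + (2 * h : ℕ) * (((lam : ℚ) * (c : ℚ) ^ 2 + 2 * ((d₀ : ℚ) - c) + 1) / 2) := by
    have hRc : R < c := by omega
    have hcq : c ≤ lam * c := Nat.le_mul_of_pos_left c hlam0
    have hRR : lam * R ≤ lam * c := Nat.mul_le_mul_left _ hRc.le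
    have h3 := hdim hlD (by omega)
    rw [pairCount_mul_of_lt hlam0 hRc] at h3
    -- `R < c < q`, so `R` is its own units digit `d₀`.
    rw [Nat.mod_eq_of_lt (by omega)] at hRmod
    rw [h3, ← hRmod]
    push_cast
    ring
  have hmid (h1 : c * q ^ h + c < D + 1) (h2 : lam * R < q ^ h) :
      (k : ℚ) = n - (2 * h : ℕ) * δbar + (2 * h : ℕ) * ((lam : ℚ) * (c : ℚ) ^ 2 / 2) := by
    have h3 := hdim hlD h2
    rw [pairCount_mul_of_le hlam0 (by omega)] at h3
    rw [h3]
    push_cast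
    ring
  refine ⟨le_minDist_of_mul_lt hq2 hh (Dvd.intro _ hr.symm) hn hord hD, ?_, ?_, ?_⟩
  · intro hle ε hε
    rw [floor_half]
    -- `D ≤ q ^ h`, and equality is the exceptional case `ε = lam`.
    have hRc : (c = 0 ∧ 1 ≤ R) ∨ (c = 1 ∧ R = 0) := by
      rcases Nat.lt_or_ge c 2 with h2 | h2
      · interval_cases c <;> omega
      · have := Nat.mul_le_mul_right (q ^ h) h2
        omega
    rcases hRc with ⟨rfl, hR1⟩ | ⟨rfl, rfl⟩
    · obtain ⟨e, ρ, he, hρ1, hρw, hR, hfl⟩ := exists_quotient_remainder hR1 hRw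
      have hεe : ε = e := by
        rw [hε, ← hfl, ← hfloor]
        push_cast
        rw [zero_mul, sub_zero]
      subst hεe
      obtain ⟨h1, h2⟩ := hsplit he hρ1 hρw hR
      have h3 := hdim h1 h2
      rw [pairCount_of_lt he (by omega)] at h3
      refine ⟨fun h4 => ?_, fun h4 _ => ?_, fun h4 => by omega⟩
      · rw [max_eq_left (by omega)] at h3
        rw [h3]
        simp
      · rw [max_eq_right (by omega)] at h3
        rw [h3]
        push_cast
        ring
    · have hεe : ε = lam := by
        have h1 : ((D + 1 : ℕ) : ℚ) - 2 = ((lam * w : ℕ) : ℤ) := by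
          push_cast
          rw [hDQ, ← hwQ]
          push_cast
          ring
        rw [hε, h1, hwQ, floor_mul_div_mul hlam0]
        push_cast
        exact Int.mul_ediv_cancel _ (by omega)
      subst hεe
      have h3 := hdim hlD (by omega)
      rw [pairCount_mul_of_lt hlam0 (by omega)] at h3
      refine ⟨fun h4 => by omega, fun _ h4 => by omega, fun _ => ?_⟩
      rw [h3]
      push_cast
      ring
  · intro hge hclt ϑ hϑ
    rw [Nat.cast_add_one D, hfloor] at hϑ
    have hcr' : c < r := by
      rw [hrQ, mul_div_cancel_left₀ _ hlamQ.ne'] at hclt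
      exact_mod_cast hclt
    have hmulw : (ϑ : ℚ) * ((q : ℚ) ^ h - 1) / lam = ϑ * w := by
      rw [hwQ]
      field_simp
    have hmulr : (ϑ : ℚ) * ((q : ℚ) - 1) / lam = ϑ * r := by
      rw [hrQ]
      field_simp
    have hϑ0 (h1 : 0 ≤ ϑ) : ∃ e ρ : ℕ, ϑ = e ∧ e < lam ∧ 1 ≤ ρ ∧ ρ ≤ w ∧ R = e * w + ρ := by
      rcases Nat.eq_zero_or_pos R with rfl | hR1
      · rw [Nat.cast_zero, zero_sub, Int.neg_one_ediv, Int.sign_eq_one_of_pos (by omega)] at hϑ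
        omega
      · obtain ⟨e, ρ, he, hρ1, hρw, hR, hfl⟩ := exists_quotient_remainder hR1 hRw
        exact ⟨e, ρ, hϑ.trans hfl, he, hρ1, hρw, hR⟩
    have hshort (h2 : (D + 1 : ℕ) ≤ (c : ℚ) * (q : ℚ) ^ h + ϑ * ((q : ℚ) ^ h - 1) / lam + c + 1)
        (h3 : 1 ≤ ϑ) : ϑ * r + (R - ϑ * w) = (d₀ : ℚ) ∧
        (k : ℚ) = n - (2 * h : ℕ) * δbar + (2 * h : ℕ) * ((lam : ℚ) * (c : ℚ) ^ 2 / 2)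
          + (2 * h : ℕ) * (((ϑ : ℚ) - 1) * c + (R - ϑ * w))
          + (2 * h : ℕ) * ((max 0 (2 * ϑ - lam - 1) : ℤ) : ℚ) / 2 := by
      obtain ⟨e, ρ, rfl, he, hρ1, hρw, hR⟩ := hϑ0 (by omega)
      have hRQ : (R : ℚ) = e * w + ρ := by exact_mod_cast hR
      have hρc : ρ ≤ c := by
        rw [Nat.cast_add_one D, hDQ, hmulw, hRQ, Int.cast_natCast] at h2
        have : (ρ : ℚ) ≤ c := by linarith
        exact_mod_cast this
      obtain ⟨h5, h6⟩ := hsplit he hρ1 hρw hR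
      have h7 := hdim h5 h6
      rw [pairCount_of_le (by omega) he hρ1 hρc] at h7
      -- `ρ ≤ c < r` keeps `e * r + ρ` below `q`, so it is the digit `d₀`.
      rw [hR, mul_add_mod_eq hq2 (by omega) hr hw he (by omega)] at hRmod
      refine ⟨?_, ?_⟩
      · rw [← hRmod, hRQ]
        push_cast
        ring
      · rw [h7, hRQ]
        push_cast
        ring
    have hlong (h1 : (c : ℚ) * (q : ℚ) ^ h + ϑ * ((q : ℚ) ^ h - 1) / lam + c + 1 < (D + 1 : ℕ))
        (h3 : 0 ≤ ϑ) :
        (k : ℚ) = n - (2 * h : ℕ) * δbar + (2 * h : ℕ) * ((lam : ℚ) * (c : ℚ) ^ 2 / 2)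
          + (2 * h : ℕ) * (ϑ * (c : ℚ))
          + (2 * h : ℕ) * ((max 0 (2 * ϑ - lam + 1) : ℤ) : ℚ) / 2 := by
      obtain ⟨e, ρ, rfl, he, hρ1, hρw, hR⟩ := hϑ0 h3
      have hRQ : (R : ℚ) = e * w + ρ := by exact_mod_cast hR
      have hρc : c < ρ := by
        rw [Nat.cast_add_one D, hDQ, hmulw, hRQ, Int.cast_natCast] at h1
        have : (c : ℚ) < ρ := by linarith
        exact_mod_cast this
      obtain ⟨h5, h6⟩ := hsplit he hρ1 hρw hR
      rw [hdim h5 h6, pairCount_of_lt he hρc]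
      push_cast
      ring
    refine ⟨hlow, fun h1 h2 => hmid h1 ?_, fun _ h2 h3 h4 => ?_, fun _ h2 h3 => ?_,
      fun h1 h2 h3 => ?_, fun h1 h2 => ?_⟩
    · rw [Nat.cast_add_one D, hDQ, hwQ, mul_div_cancel_left₀ _ hlamQ.ne'] at h2
      have h3 : (R : ℚ) ≤ w := by linarith
      have h4 : R ≤ w := by exact_mod_cast h3
      have := Nat.mul_le_mul_left lam h4
      omega
    · obtain ⟨h5, h6⟩ := hshort h2 h3
      rw [le_div_iff₀ two_pos] at h4
      have h7 : ϑ * 2 ≤ lam := by exact_mod_cast h4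
      rw [max_eq_left (by omega)] at h6
      rw [h6, hmulr, ← h5]
      push_cast
      ring
    · rw [div_lt_iff₀ two_pos] at h3
      have h7 : (lam : ℤ) < ϑ * 2 := by exact_mod_cast h3
      obtain ⟨h5, h6⟩ := hshort h2 (by omega)
      rw [max_eq_right (by omega)] at h6
      rw [h6, hmulr, ← h5]
      push_cast
      ring
    · have h6 := hlong h1 (by omega)
      rw [lt_div_iff₀ two_pos] at h3
      have h7 : ϑ * 2 < lam := by exact_mod_cast h3
      rw [max_eq_left (by omega)] at h6
      rw [h6]
      push_cast
      ring
    · rw [div_le_iff₀ two_pos] at h2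
      have h7 : (lam : ℤ) ≤ ϑ * 2 := by exact_mod_cast h2
      have h6 := hlong h1 (by omega)
      rw [max_eq_right (by omega)] at h6
      rw [h6]
      push_cast
      ring
  · intro _ hceq
    have hcr' : c = r := by
      rw [hrQ, mul_div_cancel_left₀ _ hlamQ.ne'] at hceq
      exact_mod_cast hceq
    refine ⟨hlow, fun h1 => hmid h1 ?_⟩
    subst hcr'
    -- With `lam * c = q - 1`, the bound `lam * D < q ^ (h + 1)` leaves `lam * R < q ^ h`: no carry
    -- occurs.
    have h2 : q ^ h * (lam * c) + q ^ h = q ^ (h + 1) := by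
      rw [← hr, pow_succ, ← mul_add_one, Nat.sub_add_cancel (by omega)]
    omega
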